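/- **Setting.** Let $d\in\mathbb N$. *Hopping.* Let $h:\mathbb Z^d\to\mathbb C$ satisfy $h(\zeta)=\overline{h(-\zeta)}$, $\sum_y e^{m|y|}|h(y)|<\infty$ for some $m>0$, and: for every $0\ne k\in\mathbb R^d$ there is $y$ with $k\cdot y\neq 0$ and $h(y)\ne 0$. *Environment.* Let $\Omega$ be a topological space with its Borel $\sigma$-algebra, $\mu$ a Borel probability measure, and $\sigma_x:\Omega\to\Omega$ ($x\in\mathbb Z^d$) $\mu$-preserving maps with $\sigma_0=\mathrm{id}$, $\sigma_x\circ\sigma_y=\sigma_{x+y}$. Let $(\mathbb P_a)_{a\in\Omega}$ be a measurable family of probability measures on $\Omega^{[0,\infty)}$ (product $\sigma$-algebra) such that: under $\mathbb P_a$ almost surely the path $t\mapsto \omega_t$ is right continuous with $\omega_0=a$ (i.e. the set of such paths has outer measure one); $\mathbb P_{\sigma_xa}$ is the image of $\mathbb P_a$ under $(\omega_t)_t\mapsto(\sigma_x\omega_t)_t$; $\mathbb P_a((\omega_{t+s})_{t\ge0}\in A)=\mathbb E_a(\mathbb P_{\omega_s}(A))$ for $s>0$ and measurable $A$; and $\int\mathbb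 P_a(\omega_t\in A)\,d\mu(a)=\mu(A)$ for $t>0$ and Borel $A$. Let $S_t^\dagger$ be the operators on $L^2(\Omega)=L^2(\Omega,\mu;\mathbb C)$ with $\langle g,S_t^\dagger f\rangle=\int\mathbb E_a\big(\overline{g(\omega_t)}f(\omega_0)\big)d\mu(a)$, and let $Bf=\lim_{t\downarrow0}\frac1t(f-S_t^\dagger f)$, with domain $\mathcal D(B)$ the set of $f$ for which the limit exists in $L^2$. Assume that there are $T>0$ and $b,q\in\mathbb R$ such that for all $f\in\mathcal D(B)$ with $\int f\,d\mu=0$, $$\operatorname{Re}\langle f,Bf\rangle\ge\tfrac1T\|f\|^2,\qquad |\operatorname{Im}\langle f,Bf\rangle|\le q\,|\operatorname{Re}\langle f,Bf\rangle+b|\ \text{ if moreover } \|f\|=1 .$$ *Potential.* Let $v_0\in L^\infty(\mu)$ be real valued, $v_x=v_0\circ\sigma_x$, and assume that there is $\chi>0$ with $\|B^{-1}(v_x-v_0)\|_{L^2(\Omega)}\ge\chi$ for all $x\ne0$, where $B^{-1}$ is the inverse of $B$ restricted to the mean zero functions. *Operator.* On $\mathcal H=L^2(\mathbb Z^d\times\Omega)$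 (counting measure times $\mu$) let $\widehat L_{0}=\mathrm i\widehat K+\mathrm i\widehat V+B$, where $$\widehat K\phi(x,\omega)=\sum_\zeta h(\zeta)\big[\phi(x-\zeta,\omega)-\phi(x-\zeta,\sigma_\zeta\omega)\big],\qquad \widehat V\phi(x,\omega)=(v_x(\omega)-v_0(\omega))\phi(x,\omega),$$ and $B$ acts on the variable $\omega$, on the domain of those $\phi$ with $\phi(x,\cdot)\in\mathcal D(B)$ for all $x$ and $\sum_x\|B\phi(x,\cdot)\|^2<\infty$. **Claim.** The operator $\widehat L_0$ is densely defined, and: 1. $\widehat L_0(\delta_0\otimes1)=\widehat L_0^\dagger(\delta_0\otimes1)=0$, where $(\delta_0\otimes 1)(x,\omega)=\delta_0(x)$. 2. The subspace $\widetilde{\mathcal H}=\{\delta_0\otimes1\}^\perp$ is invariant under $\widehat L_0$, and there are $0<\gamma<1$ and $p,c>0$ such that the spectrum of the restriction of $\widehat L_0$ to $\widetilde{\mathcal H}$ is contained in $$\Sigma_+=\Big\{w\in\mathbb C:\ \operatorname{Re}w\ge\frac\gamma T,\ |\operatorname{Im}w|\le p\,(\operatorname{Re}w+c)\Big\}.$$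 3. With the same $\Sigma_+$ there is $C<\infty$ such that every $w\notin\{0\}\cup\Sigma_+$ is in the resolvent set of $\widehat L_0$ and $$\big\|(\widehat L_0-wI)^{-1}\big\|\le\frac{C}{\operatorname{dist}(w,\{0\}\cup\Sigma_+)} .$$ -/

import Mathlib

open MeasureTheory ProbabilityTheory Filter Topology
open scoped NNReal ENNReal InnerProductSpace

noncomputable section

namespace MarkovAnderson

/-! ### Unbounded operators -/

section Operators

variable {E : Type*} [NormedAddCommGroup E] [NormedSpace ℂ E]

/-- Graph of the generator `f ↦ lim_{t ↓ 0} t⁻¹ (f - S_t f)`: the pairs `(f, k)` for which the limit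
exists in norm and equals `k`. -/
def generatorGraph (S : ℝ≥0 → E →L[ℂ] E) : Submodule ℂ (E × E) where
  carrier := {a | Tendsto (fun t : ℝ≥0 => ((t : ℝ) : ℂ)⁻¹ • (a.1 - S t a.1)) (𝓝[>] 0) (𝓝 a.2)}
  zero_mem' := by
    simp only [Set.mem_ofPred_eq, Prod.fst_zero, Prod.snd_zero, map_zero, sub_zero, smul_zero]
    exact tendsto_const_nhds
  add_mem' := by
    intro a b ha hb
    refine (Tendsto.add ha hb).congr fun t => ?_
    simp only [Prod.fst_add, map_add, ← smul_add]
    congr 1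
    abel
  smul_mem' := by
    intro c a ha
    refine (Tendsto.const_smul ha c).congr fun t => ?_
    simp only [Prod.smul_fst, map_smul, ← smul_sub]
    exact smul_comm _ _ _

/-- The generator `B` of `S`, with the sign convention `S_t = e^{-tB}`, on its maximal domain. -/
def generator (S : ℝ≥0 → E →L[ℂ] E) : E →ₗ.[ℂ] E := (generatorGraph S).toLinearPMap

theorem mem_generator_graph (S : ℝ≥0 → E →L[ℂ] E) (f k : E) :
    (f, k) ∈ (generator S).graph ↔
      Tendsto (fun t : ℝ≥0 => ((t : ℝ) : ℂ)⁻¹ • (f - S t f)) (𝓝[>] 0) (𝓝 k) := by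
  rw [generator, Submodule.toLinearPMap_graph_eq]
  · rfl
  · rintro ⟨f, k⟩ h (rfl : f = 0)
    refine tendsto_nhds_unique (f := fun _ : ℝ≥0 => (0 : E)) (l := 𝓝[>] (0 : ℝ≥0)) ?_
      tendsto_const_nhds
    exact Tendsto.congr (fun t => by simp) h

/-- `R` is the (bounded, everywhere defined) inverse of `A - w`. -/
def IsResolvent (A : E →ₗ.[ℂ] E) (w : ℂ) (R : E →L[ℂ] E) : Prop :=
  (∀ y, ∃ hy : R y ∈ A.domain, A ⟨R y, hy⟩ - w • R y = y) ∧
    ∀ x : A.domain, R (A x - w • (x : E)) = x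

/-- The spectrum of a partially defined operator: the complement of the resolvent set. -/
def pspectrum (A : E →ₗ.[ℂ] E) : Set ℂ := {w | ¬ ∃ R : E →L[ℂ] E, IsResolvent A w R}

/-- The operator induced by `A` in the subspace `M`: its graph is the part of the graph of `A` that
lies in `M × M`. When `M` is invariant under `A`, this is the restriction of `A` to
`A.domain ∩ M`. -/
def restrictTo (A : E →ₗ.[ℂ] E) (M : Submodule ℂ E) : M →ₗ.[ℂ] M :=
  (A.graph.comap (M.subtype.prodMap M.subtype)).toLinearPMap

theorem mem_restrictTo_graph (A : E →ₗ.[ℂ] E) (M : Submodule ℂ E) (u w : M) :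
    (u, w) ∈ (restrictTo A M).graph ↔ ((u : E), (w : E)) ∈ A.graph := by
  rw [restrictTo, Submodule.toLinearPMap_graph_eq]
  · rfl
  · rintro ⟨u, w⟩ h (rfl : u = 0)
    exact Subtype.ext (A.graph_fst_eq_zero_snd h rfl)

end Operators

/-! ### Operators on `ℓ²(ι; E)` -/

section HilbertSum

variable {ι : Type*} {E : Type*} [NormedAddCommGroup E] [NormedSpace ℂ E]

theorem memℓp_block (e : ι ≃ ι) (U : ι → E →L[ℂ] E) (M : ℝ) (hU : ∀ i, ‖U i‖ ≤ M)
    (φ : lp (fun _ : ι => E) 2) :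
    Memℓp (fun i => U i (φ (e i))) 2 := by
  refine memℓp_gen ?_
  have h := (memℓp_gen_iff (p := 2) (by simp)).1 (lp.memℓp φ)
  have h' := ((e.summable_iff.2 h).mul_left (M ^ 2))
  refine Summable.of_nonneg_of_le (fun i => by positivity) (fun i => ?_) h'
  have := (U i).le_of_opNorm_le (hU i) (φ (e i))
  simp only [ENNReal.toReal_ofNat, Real.rpow_ofNat, Function.comp_apply]
  rw [← mul_pow]
  gcongr

/-- The bounded operator `(φ_i)_i ↦ (U_i φ_{e i})_i` on `ℓ²(ι; E)`. -/
def blockOp (e : ι ≃ ι) (U : ι → E →L[ℂ] E) (M : ℝ) (hU : ∀ i, ‖U i‖ ≤ M) :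
    lp (fun _ : ι => E) 2 →L[ℂ] lp (fun _ : ι => E) 2 :=
  LinearMap.mkContinuous
    { toFun := fun φ => ⟨fun i => U i (φ (e i)), memℓp_block e U M hU φ⟩
      map_add' := fun φ ψ => by
        ext i : 2
        exact (U i).map_add _ _
      map_smul' := fun c φ => by
        ext i : 2
        exact (U i).map_smul c _ }
    (max M 0) (fun φ => by
      refine lp.norm_le_of_forall_sum_le (p := 2) (by simp) (by positivity) fun s => ?_
      simp only [ENNReal.toReal_ofNat, Real.rpow_ofNat, mul_pow]
      have h := (memℓp_gen_iff (p := 2) (by simp)).1 (lp.memℓp φ)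
      have hn := lp.norm_rpow_eq_tsum (p := 2) (by simp) φ
      simp only [ENNReal.toReal_ofNat, Real.rpow_ofNat] at h hn
      rw [hn, ← e.tsum_eq, ← tsum_mul_left]
      refine le_trans (Finset.sum_le_sum fun i _ => ?_)
        (((e.summable_iff.2 h).mul_left ((max M 0) ^ 2)).sum_le_tsum s
          fun i _ => mul_nonneg (sq_nonneg _) (sq_nonneg _))
      simp only [LinearMap.coe_mk, AddHom.coe_mk]
      rw [← mul_pow]
      have := (U i).le_of_opNorm_le ((hU i).trans (le_max_left M 0)) (φ (e i))
      gcongr)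

theorem blockOp_apply (e : ι ≃ ι) (U : ι → E →L[ℂ] E) (M : ℝ) (hU : ∀ i, ‖U i‖ ≤ M)
    (φ : lp (fun _ : ι => E) 2) (i : ι) : blockOp e U M hU φ i = U i (φ (e i)) := rfl

/-- The operator `1 ⊗ B` on `ℓ²(ι; E)`, i.e. the direct sum of copies of `B`: its graph consists of
the pairs `(φ, χ)` in `ℓ²(ι; E)` with `φ_i` in the domain of `B` and `B φ_i = χ_i` for all `i`. -/
def ampliation (ι : Type*) (B : E →ₗ.[ℂ] E) :
    lp (fun _ : ι => E) 2 →ₗ.[ℂ] lp (fun _ : ι => E) 2 :=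
  Submodule.toLinearPMap
    { carrier := {a | ∀ i, (a.1 i, a.2 i) ∈ B.graph}
      zero_mem' := fun _ => B.graph.zero_mem
      add_mem' := fun ha hb i => B.graph.add_mem (ha i) (hb i)
      smul_mem' := fun c _ ha i => B.graph.smul_mem c (ha i) }

theorem mem_ampliation_graph (B : E →ₗ.[ℂ] E) (φ χ : lp (fun _ : ι => E) 2) :
    (φ, χ) ∈ (ampliation ι B).graph ↔ ∀ i, (φ i, χ i) ∈ B.graph := by
  rw [ampliation, Submodule.toLinearPMap_graph_eq]
  · rfl
  · rintro ⟨φ, χ⟩ h (rfl : φ = 0)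
    ext i : 2
    exact B.graph_fst_eq_zero_snd (h i) rfl

end HilbertSum

/-! ### The model -/

/-- A hopping kernel on `ℤ^d`: self-adjoint, exponentially bounded and non-degenerate. -/
structure HoppingKernel (d : ℕ) where
  h : (Fin d → ℤ) → ℂ
  self_adjoint : ∀ ζ, h ζ = starRingEnd ℂ (h (-ζ))
  exp_bound : ∃ m : ℝ, 0 < m ∧ Summable fun y : Fin d → ℤ => Real.exp (m * ‖y‖) * ‖h y‖
  nondegenerate : ∀ k : Fin d → ℝ, k ≠ 0 → ∃ y : Fin d → ℤ, ∑ i, k i * (y i : ℝ) ≠ 0 ∧ h y ≠ 0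

variable {d : ℕ} {Ω : Type*} [MeasurableSpace Ω] {μ : Measure Ω}

/-- The augmented Hilbert space `L²(ℤ^d × Ω)` (counting measure times `μ`), as the space
`ℓ²(ℤ^d; L²(Ω, μ))` of square summable families `φ x = φ(x, ·)`. -/
abbrev AugSpace (d : ℕ) (μ : Measure Ω) : Type _ :=
  lp (fun _ : Fin d → ℤ => Lp ℂ 2 μ) 2

/-- The vector `δ₀ ⊗ 1`. -/
def deltaOne (d : ℕ) (μ : Measure Ω) [IsFiniteMeasure μ] : AugSpace d μ :=
  lp.single 2 0 (Lp.const 2 μ (1 : ℂ))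

/-- For a bounded operator `U` on `L²(Ω, μ)`: `φ ↦ ((x, ·) ↦ U (φ(x - ζ, ·)))`. -/
def translate (ζ : Fin d → ℤ) (U : Lp ℂ 2 μ →L[ℂ] Lp ℂ 2 μ) :
    AugSpace d μ →L[ℂ] AugSpace d μ :=
  blockOp (Equiv.subRight ζ) (fun _ => U) ‖U‖ (fun _ => le_rfl)

/-- Multiplication of `L²` functions by an `L^∞` function. -/
def mulL2 (m : Lp ℂ ∞ μ) : Lp ℂ 2 μ →L[ℂ] Lp ℂ 2 μ :=
  (ContinuousLinearMap.mul ℂ ℂ).holderL μ ∞ 2 2 m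

theorem norm_mulL2_le (m : Lp ℂ ∞ μ) : ‖mulL2 m‖ ≤ ‖m‖ := by
  refine ((ContinuousLinearMap.mul ℂ ℂ).holderL μ ∞ 2 2).le_of_opNorm_le (c := 1) ?_ m |>.trans
    (one_mul _).le
  exact ((ContinuousLinearMap.mul ℂ ℂ).norm_holderL_le (μ := μ) (p := ∞) (q := 2) (r := 2)).trans
    (ContinuousLinearMap.opNorm_mul_le ℂ ℂ)

variable [TopologicalSpace Ω]

/-- The environment: measure preserving shifts `σ_x`, `x ∈ ℤ^d`, of `(Ω, μ)` together with a
shift invariant Markov process on `Ω`, given by its path measures `P_a`, `a ∈ Ω`, on `Ω^[0,∞)`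
with the product σ-algebra, that has right continuous paths and leaves `μ` invariant.

The set of right continuous paths is in general not measurable for the product σ-algebra, and
"almost surely right continuous" means that it has outer measure one. This is what `right_cont`
says, a measure in Mathlib being applied to arbitrary sets as an outer measure. -/
structure Environment (d : ℕ) (μ : Measure Ω) where
  σ : (Fin d → ℤ) → Ω → Ω
  σ_preserving : ∀ x, MeasurePreserving (σ x) μ μ
  σ_zero : σ 0 = id
  σ_add : ∀ x y, σ x ∘ σ y = σ (x + y)
  P : Kernel Ω (ℝ≥0 → Ω)
  isMarkov : IsMarkovKernel P
  right_cont : ∀ a, P a {ω | (∀ t, ContinuousWithinAt ω (Set.Ici t) t) ∧ ω 0 = a} = 1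
  shift_inv : ∀ x a, P (σ x a) = (P a).map (fun ω t => σ x (ω t))
  markov : ∀ s : ℝ≥0, 0 < s → ∀ A : Set (ℝ≥0 → Ω), MeasurableSet A → ∀ a,
    P a ((fun ω t => ω (t + s)) ⁻¹' A) = ∫⁻ ω, P (ω s) A ∂(P a)
  invariant : ∀ t : ℝ≥0, 0 < t → ∀ A : Set Ω, MeasurableSet A →
    ∫⁻ a, P a {ω | ω t ∈ A} ∂μ = μ A

namespace Environment

variable (X : Environment d μ)

/-- The joint law of the paths with initial point distributed according to `μ`; integrals with
respect to it are the joint average `∫ E_a(·) dμ(a)`. -/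
def pathLaw : Measure (ℝ≥0 → Ω) := μ.bind X.P

theorem prob_initial (a : Ω) {A : Set Ω} (hA : MeasurableSet A) :
    X.P a {ω | ω 0 ∈ A} = A.indicator 1 a := by
  have := X.isMarkov
  by_cases ha : a ∈ A
  · rw [Set.indicator_of_mem ha, Pi.one_apply]
    refine le_antisymm prob_le_one ?_
    rw [← X.right_cont a]
    refine measure_mono fun ω hω => ?_
    change ω 0 ∈ A
    rw [hω.2]; exact ha
  · rw [Set.indicator_of_notMem ha]
    have hm : MeasurableSet {ω : ℝ≥0 → Ω | ω 0 ∈ A} := measurable_pi_apply 0 hA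
    rw [← prob_compl_eq_one_iff hm]
    refine le_antisymm prob_le_one ?_
    rw [← X.right_cont a]
    refine measure_mono fun ω hω => ?_
    change ¬ ω 0 ∈ A
    rw [hω.2]; exact ha

theorem eval_preserving (t : ℝ≥0) :
    MeasurePreserving (fun ω : ℝ≥0 → Ω => ω t) X.pathLaw μ := by
  refine ⟨measurable_pi_apply t, Measure.ext fun A hA => ?_⟩
  have hm : MeasurableSet {ω : ℝ≥0 → Ω | ω t ∈ A} := measurable_pi_apply t hA
  rw [Measure.map_apply (measurable_pi_apply t) hA, pathLaw]
  change (μ.bind X.P) {ω : ℝ≥0 → Ω | ω t ∈ A} = μ A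
  rw [Measure.bind_apply hm X.P.measurable.aemeasurable]
  rcases eq_or_lt_of_le (show 0 ≤ t from zero_le) with rfl | ht
  · simp_rw [X.prob_initial _ hA]
    rw [lintegral_indicator_one hA]
  · exact X.invariant t ht A hA

/-- `g ↦ g(ω_t)`, as an isometry from `L²(Ω, μ)` into `L²` of the path space. -/
def evalL2 (t : ℝ≥0) : Lp ℂ 2 μ →L[ℂ] Lp ℂ 2 X.pathLaw :=
  (Lp.compMeasurePreservingₗᵢ ℂ (fun ω : ℝ≥0 → Ω => ω t) (X.eval_preserving t)).toContinuousLinearMap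

/-- The backward semigroup `S_t^†` on `L²(Ω, μ)`, the adjoint of `S_t f(a) = E_a f(ω_t)`; it is
determined by `⟨g, S_t^† f⟩ = ∫ E_a (conj (g(ω_t)) f(ω_0)) dμ(a)` for all `g`. -/
def adjSemigroup (t : ℝ≥0) : Lp ℂ 2 μ →L[ℂ] Lp ℂ 2 μ :=
  (ContinuousLinearMap.adjoint (X.evalL2 t)).comp (X.evalL2 0)

/-- The Markov generator `B f = lim_{t ↓ 0} t⁻¹ (f - S_t^† f)` in `L²(Ω, μ)`. -/
def B : Lp ℂ 2 μ →ₗ.[ℂ] Lp ℂ 2 μ := generator X.adjSemigroup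

/-- The gap condition with time constant `T`, on the mean zero part of the domain of `B`. -/
def HasGap (T : ℝ) : Prop :=
  ∀ f : X.B.domain, ∫ ω, (f : Lp ℂ 2 μ) ω ∂μ = 0 →
    1 / T * ‖(f : Lp ℂ 2 μ)‖ ^ 2 ≤ (⟪(f : Lp ℂ 2 μ), X.B f⟫_ℂ).re

/-- Sectoriality of `B` on the mean zero part of its domain: the numerical range (the values at
unit vectors) satisfies `|Im w| ≤ q |Re w + b|`. -/
def IsSectorial (q b : ℝ) : Prop :=
  ∀ f : X.B.domain, ∫ ω, (f : Lp ℂ 2 μ) ω ∂μ = 0 → ‖(f : Lp ℂ 2 μ)‖ = 1 →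
    |(⟪(f : Lp ℂ 2 μ), X.B f⟫_ℂ).im| ≤ q * |(⟪(f : Lp ℂ 2 μ), X.B f⟫_ℂ).re + b|

/-- The non-degeneracy condition `‖B⁻¹ (v_x - v_0)‖ ≥ χ` for `x ≠ 0`, where `v_x = v ∘ σ_x` and
`B⁻¹` is the inverse of `B` on the mean zero functions. -/
def PotentialNondegenerate (v : Ω → ℝ) (χ : ℝ) : Prop :=
  ∀ x : Fin d → ℤ, x ≠ 0 → ∀ u : X.B.domain, ∫ ω, (u : Lp ℂ 2 μ) ω ∂μ = 0 →
    (X.B u =ᵐ[μ] fun ω => ((v (X.σ x ω) - v (X.σ 0 ω) : ℝ) : ℂ)) → χ ≤ ‖(u : Lp ℂ 2 μ)‖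

/-- `f ↦ f ∘ σ_ζ` on `L²(Ω, μ)`. -/
def shiftL2 (ζ : Fin d → ℤ) : Lp ℂ 2 μ →L[ℂ] Lp ℂ 2 μ :=
  (Lp.compMeasurePreservingₗᵢ ℂ (X.σ ζ) (X.σ_preserving ζ)).toContinuousLinearMap

/-- The hopping term
`K̂_z φ(x, ω) = ∑_ζ h(ζ) [φ(x - ζ, ω) - e^{-i z·ζ} φ(x - ζ, σ_ζ ω)]`. -/
def hopping (k : HoppingKernel d) (z : Fin d → ℂ) : AugSpace d μ →L[ℂ] AugSpace d μ :=
  ∑' ζ : Fin d → ℤ, k.h ζ • (translate ζ (ContinuousLinearMap.id ℂ (Lp ℂ 2 μ)) -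
    Complex.exp (-Complex.I * ∑ i, z i * (ζ i : ℂ)) • translate ζ (X.shiftL2 ζ))

theorem memLp_ofReal_shift {v : Ω → ℝ} (hv : MemLp v ∞ μ) (x : Fin d → ℤ) :
    MemLp (fun ω => ((v (X.σ x ω) : ℝ) : ℂ)) ∞ μ :=
  (hv.comp_measurePreserving (X.σ_preserving x)).ofReal

/-- The function `v_x = v ∘ σ_x` as an element of `L^∞(Ω, μ; ℂ)`. -/
def potentialAt {v : Ω → ℝ} (hv : MemLp v ∞ μ) (x : Fin d → ℤ) : Lp ℂ ∞ μ :=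
  (X.memLp_ofReal_shift hv x).toLp _

theorem norm_potentialAt {v : Ω → ℝ} (hv : MemLp v ∞ μ) (x : Fin d → ℤ) :
    ‖X.potentialAt hv x‖ ≤ ‖hv.toLp v‖ := by
  rw [potentialAt, Lp.norm_toLp, Lp.norm_toLp,
    ← eLpNorm_comp_measurePreserving hv.1 (X.σ_preserving x)]
  refine ENNReal.toReal_mono ?_ (eLpNorm_mono fun ω => by simp)
  exact (hv.comp_measurePreserving (X.σ_preserving x)).2.ne

/-- The potential term `V̂ φ(x, ω) = (v_x(ω) - v_0(ω)) φ(x, ω)`. -/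
def potential {v : Ω → ℝ} (hv : MemLp v ∞ μ) : AugSpace d μ →L[ℂ] AugSpace d μ :=
  blockOp (Equiv.refl _) (fun x => mulL2 (X.potentialAt hv x - X.potentialAt hv 0))
    (‖hv.toLp v‖ + ‖hv.toLp v‖) (fun x => (norm_mulL2_le _).trans ((norm_sub_le _ _).trans
      (add_le_add (X.norm_potentialAt hv x) (X.norm_potentialAt hv 0))))

/-- The operator `L̂_z = i K̂_z + i V̂ + B` on the domain of (the ampliation of) `B`. -/
def L (k : HoppingKernel d) {v : Ω → ℝ} (hv : MemLp v ∞ μ) (z : Fin d → ℂ) :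
    AugSpace d μ →ₗ.[ℂ] AugSpace d μ :=
  (Complex.I • X.hopping k z + Complex.I • X.potential hv : AugSpace d μ →L[ℂ] AugSpace d μ).toLinearMap
    +ᵥ ampliation (Fin d → ℤ) X.B

end Environment

/-- The truncated sector `{w : Re w ≥ γ / T, |Im w| ≤ p (Re w + c)}`. -/
def truncatedSector (T γ p c : ℝ) : Set ℂ :=
  {w | γ / T ≤ w.re ∧ |w.im| ≤ p * (w.re + c)}

end MarkovAnderson

end

open MarkovAnderson

/-!
The operators `S_t†` form a strongly continuous semigroup of contractions which fixes the constants,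
so `B` is m-accretive, and so is `L̂₀ = i (K̂ + V̂) + B`, since `K̂ + V̂` is bounded and symmetric.
Both `L̂₀` and its adjoint annihilate `δ₀ ⊗ 1`.

Let `φ ⊥ δ₀ ⊗ 1` and write `φ = ψ ⊗ 1 + η` with `η` of mean zero at every site, so that `ψ(0) = 0`.
The gap of `B` bounds `‖η‖² / T` by `Re ⟨φ, L̂₀ φ⟩` but says nothing about `ψ`. Now `K̂` kills
`ψ ⊗ 1` and `V̂` maps it to `ψ(x) (v_x - v_0)`, which must be compensated by `B η` if `(L̂₀ - w) φ`
is to be small: the lower bound on `B⁻¹ (v_x - v_0)` then bounds `‖ψ‖` by `‖η‖` and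
`‖(L̂₀ - w) φ‖`. Hence `L̂₀ - w` is bounded below on `{δ₀ ⊗ 1}^⊥`, uniformly on bounded sets of `w`
with `Re w ≤ γ / T`, for `γ` small. Since the numerical range of `L̂₀` lies in a sector, such a
bound also holds for large `w` outside a wider sector, and the resolvent, which exists for
`Re w < 0`, continues to the whole complement of the truncated sector.
-/

noncomputable section

namespace MarkovAnderson

/-! ### Resolvents -/

section Resolvents

variable {E : Type*} [NormedAddCommGroup E] [NormedSpace ℂ E] {A : E →ₗ.[ℂ] E} {w : ℂ}
  {R : E →L[ℂ] E}

theorem isResolvent_iff_graph :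
    IsResolvent A w R ↔ (∀ y, (R y, y + w • R y) ∈ A.graph) ∧
      ∀ ⦃x z⦄, (x, z) ∈ A.graph → R (z - w • x) = x := by
  refine and_congr (forall_congr' fun y => ⟨?_, fun h => ?_⟩)
    ⟨fun h x z hxz => ?_, fun h x => h (A.mem_graph x)⟩
  · rintro ⟨hy, h⟩
    rw [← sub_eq_iff_eq_add.1 h]
    exact A.mem_graph ⟨R y, hy⟩
  · have hy := LinearPMap.mem_domain_of_mem_graph h
    exact ⟨hy, sub_eq_iff_eq_add.2 (A.mem_graph_snd_inj (A.mem_graph ⟨R y, hy⟩) h rfl)⟩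
  · obtain ⟨y, rfl, rfl⟩ := A.mem_graph_iff.1 hxz
    exact h y

theorem mem_vadd_graph {D : E →ₗ[ℂ] E} {x z : E} :
    (x, z) ∈ (D +ᵥ A).graph ↔ (x, z - D x) ∈ A.graph := by
  simp only [LinearPMap.mem_graph_iff]
  refine exists_congr fun y => and_congr_right ?_
  rintro rfl
  rw [LinearPMap.vadd_apply, eq_sub_iff_add_eq']

/-- `A - w` is bounded below by `m`, on the domain of `A`. -/
def IsBoundedBelowAt (A : E →ₗ.[ℂ] E) (w : ℂ) (m : ℝ) : Prop :=
  ∀ ⦃x z⦄, (x, z) ∈ A.graph → m * ‖x‖ ≤ ‖z - w • x‖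

theorem IsBoundedBelowAt.mono {m m' : ℝ} (hA : IsBoundedBelowAt A w m) (h : m' ≤ m) :
    IsBoundedBelowAt A w m' := fun x _ hxz =>
  (mul_le_mul_of_nonneg_right h (norm_nonneg x)).trans (hA hxz)

theorem IsBoundedBelowAt.restrictTo {m : ℝ} (hA : IsBoundedBelowAt A w m) (M : Submodule ℂ E) :
    IsBoundedBelowAt (restrictTo A M) w m := fun x z hxz =>
  hA ((mem_restrictTo_graph A M x z).1 hxz)

theorem IsResolvent.norm_le {m : ℝ} (hR : IsResolvent A w R) (hm : 0 < m)
    (hA : IsBoundedBelowAt A w m) : ‖R‖ ≤ 1 / m := by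
  refine R.opNorm_le_bound (by positivity) fun y => ?_
  rw [one_div_mul_eq_div, le_div_iff₀' hm]
  simpa using hA ((isResolvent_iff_graph.1 hR).1 y)

theorem IsBoundedBelowAt.isResolvent_of_mem_graph {m : ℝ} (hA : IsBoundedBelowAt A w m)
    (hm : 0 < m) (hR : ∀ y, (R y, y + w • R y) ∈ A.graph) : IsResolvent A w R := by
  refine isResolvent_iff_graph.2 ⟨hR, fun x z hxz => ?_⟩
  have hle := hA (A.graph.sub_mem (hR (z - w • x)) hxz)
  have hzero : z - w • x + w • R (z - w • x) - z - w • (R (z - w • x) - x) = 0 := by module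
  simp only [hzero, norm_zero] at hle
  exact sub_eq_zero.1 (norm_le_zero_iff.1 (nonpos_of_mul_nonpos_right hle hm))

/-- The Neumann series: `R (1 + D R)⁻¹` is the resolvent of `D + A`. -/
theorem IsResolvent.vadd [CompleteSpace E] (hR : IsResolvent A w R) {D : E →L[ℂ] E}
    (hD : ‖D‖ * ‖R‖ < 1) : ∃ R', IsResolvent (D.toLinearMap +ᵥ A) w R' := by
  have hDR : ‖-(D * R)‖ < 1 := (norm_neg (D * R)).trans_lt ((norm_mul_le D R).trans_lt hD)
  obtain ⟨u, hu⟩ := isUnit_one_sub_of_norm_lt_one hDR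
  rw [sub_neg_eq_add] at hu
  have hu_apply (y : E) : (u : E →L[ℂ] E) y = y + D (R y) := by rw [hu]; rfl
  have mul_inv_apply (y : E) : (u : E →L[ℂ] E) ((↑u⁻¹ : E →L[ℂ] E) y) = y := by
    rw [← mul_apply_eq_comp, u.mul_inv, one_apply_eq_self]
  have inv_mul_apply (y : E) : (↑u⁻¹ : E →L[ℂ] E) ((u : E →L[ℂ] E) y) = y := by
    rw [← mul_apply_eq_comp, u.inv_mul, one_apply_eq_self]
  obtain ⟨hR_mem, hR_left⟩ := isResolvent_iff_graph.1 hR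
  refine ⟨R * (↑u⁻¹ : E →L[ℂ] E), isResolvent_iff_graph.2 ⟨fun y => ?_, fun x z hxz => ?_⟩⟩
  · set y' := (↑u⁻¹ : E →L[ℂ] E) y with hy'
    have hy : y = y' + D (R y') := by rw [← hu_apply, mul_inv_apply]
    rw [mem_vadd_graph, mul_apply_eq_comp, ContinuousLinearMap.coe_coe, ← hy', hy,
      add_right_comm, add_sub_cancel_right]
    exact hR_mem y'
  · rw [mem_vadd_graph, ContinuousLinearMap.coe_coe] at hxz
    have hx := hR_left hxz
    have hz : z - w • x = (u : E →L[ℂ] E) (z - D x - w • x) := by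
      rw [hu_apply, hx]; abel
    rw [mul_apply_eq_comp, hz, inv_mul_apply, hx]

theorem IsResolvent.exists_of_norm_sub_mul_lt [CompleteSpace E] (hR : IsResolvent A w R) {w' : ℂ}
    (h : ‖w - w'‖ * ‖R‖ < 1) : ∃ R', IsResolvent A w' R' := by
  have hnorm : ‖(w - w') • ContinuousLinearMap.id ℂ E‖ ≤ ‖w - w'‖ := by
    rw [norm_smul]
    exact mul_le_of_le_one_right (norm_nonneg _) ContinuousLinearMap.norm_id_le
  obtain ⟨R', hR'⟩ := hR.vadd ((mul_le_mul_of_nonneg_right hnorm (norm_nonneg R)).trans_lt h)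
  refine ⟨R', isResolvent_iff_graph.2 ?_⟩
  simp only [isResolvent_iff_graph, mem_vadd_graph, ContinuousLinearMap.coe_coe, smul_apply,
    ContinuousLinearMap.id_apply] at hR'
  refine ⟨fun y => ?_, fun x z hxz => ?_⟩
  · convert hR'.1 y using 2
    module
  · convert hR'.2 (x := x) (z := z + (w - w') • x) (by rwa [add_sub_cancel_right]) using 2
    module

theorem exists_isResolvent_of_isPreconnected [CompleteSpace E] {S : Set ℂ} (hS : IsPreconnected S)
    {m : ℝ} (hm : 0 < m) (hA : ∀ w ∈ S, IsBoundedBelowAt A w m) {w₀ w₁ : ℂ} (h₀ : w₀ ∈ S)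
    (h₁ : w₁ ∈ S) (hR : ∃ R, IsResolvent A w₀ R) : ∃ R, IsResolvent A w₁ R := by
  have step {w w' : ℂ} (hw : w ∈ S) (hdist : dist w w' < m) :
      (∃ R, IsResolvent A w R) → ∃ R, IsResolvent A w' R := by
    rintro ⟨R, hR⟩
    refine hR.exists_of_norm_sub_mul_lt ?_
    calc ‖w - w'‖ * ‖R‖ ≤ ‖w - w'‖ * (1 / m) := by gcongr; exact hR.norm_le hm (hA w hw)
      _ < 1 := by rwa [mul_one_div, div_lt_one hm, ← dist_eq_norm]
  refine hS.induction₂' (fun w w' => (∃ R, IsResolvent A w R) → ∃ R, IsResolvent A w' R)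
    (fun w hw => ?_) (fun _ _ _ _ _ _ h h' => h' ∘ h) h₀ h₁ hR
  filter_upwards [self_mem_nhdsWithin, mem_nhdsWithin_of_mem_nhds (Metric.ball_mem_nhds w hm)]
    with w' hw' hdist
  exact ⟨step hw (dist_comm w w' ▸ hdist), step hw' hdist⟩

theorem IsResolvent.restrictTo (hR : IsResolvent A w R) {M : Submodule ℂ E}
    (hM : ∀ y ∈ M, R y ∈ M) :
    IsResolvent (restrictTo A M) w
      ((R.comp M.subtypeL).codRestrict M fun y => hM y y.2) := by
  simp only [isResolvent_iff_graph, mem_restrictTo_graph] at hR ⊢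
  exact ⟨fun y => hR.1 y, fun x z hxz => Subtype.ext (hR.2 hxz)⟩

theorem IsResolvent.ampliation (ι : Type*) (hR : IsResolvent A w R) :
    IsResolvent (ampliation ι A) w (blockOp (Equiv.refl ι) (fun _ => R) ‖R‖ fun _ => le_rfl) := by
  simp only [isResolvent_iff_graph, mem_ampliation_graph] at hR ⊢
  exact ⟨fun y i => hR.1 (y i), fun x z hxz => lp.ext (funext fun i => hR.2 (hxz i))⟩

end Resolvents

/-! ### Accretive and sectorial operators -/

section Accretive

theorem hasSum_norm_sq {ι E : Type*} [NormedAddCommGroup E]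
    (x : lp (fun _ : ι => E) 2) :
    HasSum (fun i => ‖x i‖ ^ 2) (‖x‖ ^ 2) := by
  simpa using lp.hasSum_norm (p := 2) (by simp) x

variable {E : Type*} [NormedAddCommGroup E] [InnerProductSpace ℂ E] {A : E →ₗ.[ℂ] E}

theorem inner_smul_self_eq (w : ℂ) (x : E) : ⟪x, w • x⟫_ℂ = w * (‖x‖ ^ 2 : ℝ) := by
  rw [inner_smul_right, inner_self_eq_norm_sq_to_K, Complex.ofReal_pow]
  rfl

theorem re_inner_smul_self (w : ℂ) (x : E) : (⟪x, w • x⟫_ℂ).re = w.re * ‖x‖ ^ 2 := by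
  rw [inner_smul_self_eq, Complex.re_mul_ofReal]

theorem im_inner_smul_self (w : ℂ) (x : E) : (⟪x, w • x⟫_ℂ).im = w.im * ‖x‖ ^ 2 := by
  rw [inner_smul_self_eq, Complex.im_mul_ofReal]

theorem abs_re_inner_le_norm (x y : E) : |(⟪x, y⟫_ℂ).re| ≤ ‖x‖ * ‖y‖ :=
  (Complex.abs_re_le_norm _).trans (norm_inner_le_norm x y)

theorem abs_im_inner_le_norm (x y : E) : |(⟪x, y⟫_ℂ).im| ≤ ‖x‖ * ‖y‖ :=
  (Complex.abs_im_le_norm _).trans (norm_inner_le_norm x y)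

theorem sub_re_mul_norm_le_norm_sub_smul {x z : E} {a : ℝ} (w : ℂ)
    (h : a * ‖x‖ ^ 2 ≤ (⟪x, z⟫_ℂ).re) : (a - w.re) * ‖x‖ ≤ ‖z - w • x‖ := by
  rcases eq_or_ne x 0 with rfl | hx
  · simp
  refine le_of_mul_le_mul_left ?_ (norm_pos_iff.2 hx)
  calc ‖x‖ * ((a - w.re) * ‖x‖) = a * ‖x‖ ^ 2 - w.re * ‖x‖ ^ 2 := by ring
    _ ≤ (⟪x, z - w • x⟫_ℂ).re := by
      rw [inner_sub_right, Complex.sub_re, re_inner_smul_self]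
      gcongr
    _ ≤ ‖x‖ * ‖z - w • x‖ := re_inner_le_norm (𝕜 := ℂ) x _

/-- Maximal accretive operators: the real part of the form `⟪x, A x⟫` is non-negative, and the
range of `A + a` is the whole space for some `a > 0`. -/
structure IsMAccretive (A : E →ₗ.[ℂ] E) : Prop where
  re_inner_nonneg : ∀ ⦃x z⦄, (x, z) ∈ A.graph → 0 ≤ (⟪x, z⟫_ℂ).re
  exists_isResolvent_neg : ∃ a : ℝ, 0 < a ∧ ∃ R, IsResolvent A (-a : ℂ) R

namespace IsMAccretive

theorem isBoundedBelowAt (hA : IsMAccretive A) (w : ℂ) : IsBoundedBelowAt A w (-w.re) :=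
  fun x z hxz => by
    have h := sub_re_mul_norm_le_norm_sub_smul w (a := 0)
      ((zero_mul _).trans_le (hA.re_inner_nonneg hxz))
    rwa [zero_sub] at h

theorem exists_isResolvent [CompleteSpace E] (hA : IsMAccretive A) {w : ℂ} (hw : w.re < 0) :
    ∃ R, IsResolvent A w R := by
  obtain ⟨a, ha, hR⟩ := hA.exists_isResolvent_neg
  set r := max (-a) w.re
  have hr : 0 < -r := neg_pos.2 (max_lt (neg_lt_zero.2 ha) hw)
  refine exists_isResolvent_of_isPreconnected (convex_halfSpace_re_le r).isPreconnected hr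
    (fun u hu => (hA.isBoundedBelowAt u).mono (neg_le_neg hu)) (w₀ := (-a : ℂ)) ?_
    (le_max_right (-a) w.re) hR
  rw [Set.mem_ofPred_eq, Complex.neg_re, Complex.ofReal_re]
  exact le_max_left (-a) w.re

theorem vadd [CompleteSpace E] (hA : IsMAccretive A) {D : E →L[ℂ] E}
    (hD : ∀ x, 0 ≤ (⟪x, D x⟫_ℂ).re) : IsMAccretive (D.toLinearMap +ᵥ A) where
  re_inner_nonneg x z hxz := by
    have h := add_nonneg (hA.re_inner_nonneg (mem_vadd_graph.1 hxz)) (hD x)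
    rwa [← Complex.add_re, ← inner_add_right, ContinuousLinearMap.coe_coe, sub_add_cancel] at h
  exists_isResolvent_neg := by
    have ha : 0 < ‖D‖ + 1 := by positivity
    set w : ℂ := -((‖D‖ + 1 : ℝ) : ℂ) with hw
    have hre : -w.re = ‖D‖ + 1 := by rw [hw, Complex.neg_re, neg_neg, Complex.ofReal_re]
    obtain ⟨R, hR⟩ := hA.exists_isResolvent (w := w) (by linarith)
    have hRnorm : ‖R‖ ≤ 1 / (‖D‖ + 1) := hR.norm_le ha (hre ▸ hA.isBoundedBelowAt w)
    refine ⟨‖D‖ + 1, ha, hR.vadd ?_⟩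
    calc ‖D‖ * ‖R‖ ≤ ‖D‖ * (1 / (‖D‖ + 1)) := by gcongr
      _ < 1 := by rw [mul_one_div, div_lt_one ha]; linarith

theorem ampliation (ι : Type*) (hA : IsMAccretive A) : IsMAccretive (ampliation ι A) where
  re_inner_nonneg x z hxz :=
    (Complex.hasSum_re (lp.hasSum_inner x z)).nonneg fun i =>
      hA.re_inner_nonneg ((mem_ampliation_graph A x z).1 hxz i)
  exists_isResolvent_neg := by
    obtain ⟨a, ha, R, hR⟩ := hA.exists_isResolvent_neg
    exact ⟨a, ha, _, hR.ampliation ι⟩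

theorem dense_domain [CompleteSpace E] (hA : IsMAccretive A) : Dense (A.domain : Set E) := by
  rw [Submodule.dense_iff_topologicalClosure_eq_top, Submodule.topologicalClosure_eq_top_iff,
    Submodule.eq_bot_iff]
  intro g hg
  obtain ⟨a, ha, R, hR⟩ := hA.exists_isResolvent_neg
  have hmem := (isResolvent_iff_graph.1 hR).1 g
  have horth : ⟪R g, g⟫_ℂ = 0 := (Submodule.mem_orthogonal _ _).1 hg _
    (LinearPMap.mem_domain_of_mem_graph hmem)
  have hre := hA.re_inner_nonneg hmem
  rw [inner_add_right, horth, zero_add, re_inner_smul_self, Complex.neg_re, Complex.ofReal_re,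
    neg_mul] at hre
  have hRg : R g = 0 := by
    have h : ‖R g‖ ^ 2 ≤ 0 := nonpos_of_mul_nonpos_right (neg_nonneg.1 hre) ha
    exact norm_eq_zero.1 (pow_eq_zero_iff two_ne_zero |>.1 (h.antisymm (sq_nonneg _)))
  rw [hRg, smul_zero, add_zero] at hmem
  exact A.graph_fst_eq_zero_snd hmem rfl

end IsMAccretive

/-- The numerical range of `A` lies in the sector `|Im w| ≤ Q (Re w + β)`, as an inequality between
quadratic forms. -/
def HasSectorialForm (A : E →ₗ.[ℂ] E) (Q β : ℝ) : Prop :=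
  ∀ ⦃x z⦄, (x, z) ∈ A.graph → |(⟪x, z⟫_ℂ).im| ≤ Q * ((⟪x, z⟫_ℂ).re + β * ‖x‖ ^ 2)

namespace HasSectorialForm

variable {Q β : ℝ}

theorem abs_im_sub_mul_norm_le (hA : HasSectorialForm A Q β) (hQ : 0 ≤ Q) (w : ℂ) {x z : E}
    (hxz : (x, z) ∈ A.graph) :
    (|w.im| - Q * (w.re + β)) * ‖x‖ ≤ (1 + Q) * ‖z - w • x‖ := by
  rcases eq_or_ne x 0 with rfl | hx
  · rw [norm_zero, mul_zero]; positivity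
  refine le_of_mul_le_mul_left ?_ (norm_pos_iff.2 hx)
  have hre := (abs_le.1 (abs_re_inner_le_norm x (z - w • x))).2
  have him := abs_im_inner_le_norm x (z - w • x)
  rw [inner_sub_right, Complex.sub_re, re_inner_smul_self] at hre
  rw [inner_sub_right, Complex.sub_im, im_inner_smul_self] at him
  have htri : |w.im| * ‖x‖ ^ 2 ≤ |(⟪x, z⟫_ℂ).im| + ‖x‖ * ‖z - w • x‖ := by
    rw [← abs_of_nonneg (sq_nonneg ‖x‖), ← abs_mul]
    linarith [abs_sub_abs_le_abs_sub (w.im * ‖x‖ ^ 2) (⟪x, z⟫_ℂ).im,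
      abs_sub_comm (w.im * ‖x‖ ^ 2) (⟪x, z⟫_ℂ).im]
  have hform : |(⟪x, z⟫_ℂ).im| ≤
      Q * (‖x‖ * ‖z - w • x‖ + w.re * ‖x‖ ^ 2 + β * ‖x‖ ^ 2) :=
    (hA hxz).trans (by gcongr; linarith)
  linarith

theorem vadd (hA : HasSectorialForm A Q β) (hQ : 1 ≤ Q) (D : E →L[ℂ] E) :
    HasSectorialForm (D.toLinearMap +ᵥ A) Q (β + 2 * ‖D‖) := by
  intro x z hxz
  have hform := hA (mem_vadd_graph.1 hxz)
  have hDx : ‖x‖ * ‖D x‖ ≤ ‖D‖ * ‖x‖ ^ 2 := by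
    rw [sq, mul_left_comm]
    exact mul_le_mul_of_nonneg_left (D.le_opNorm x) (norm_nonneg x)
  have hre := (abs_le.1 ((abs_re_inner_le_norm x (D x)).trans hDx)).1
  have him := (abs_im_inner_le_norm x (D x)).trans hDx
  rw [ContinuousLinearMap.coe_coe, inner_sub_right, Complex.sub_im, Complex.sub_re] at hform
  calc |(⟪x, z⟫_ℂ).im|
      ≤ |(⟪x, z⟫_ℂ).im - (⟪x, D x⟫_ℂ).im| + |(⟪x, D x⟫_ℂ).im| := by
        simpa using abs_add_le ((⟪x, z⟫_ℂ).im - (⟪x, D x⟫_ℂ).im) (⟪x, D x⟫_ℂ).im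
    _ ≤ Q * ((⟪x, z⟫_ℂ).re - (⟪x, D x⟫_ℂ).re + β * ‖x‖ ^ 2) + 1 * (‖D‖ * ‖x‖ ^ 2) := by
        rw [one_mul]; exact add_le_add hform him
    _ ≤ Q * ((⟪x, z⟫_ℂ).re + ‖D‖ * ‖x‖ ^ 2 + β * ‖x‖ ^ 2) + Q * (‖D‖ * ‖x‖ ^ 2) := by
        gcongr; linarith
    _ = Q * ((⟪x, z⟫_ℂ).re + (β + 2 * ‖D‖) * ‖x‖ ^ 2) := by ring

theorem isBoundedBelowAt_of_mul_lt_abs_im (hA : HasSectorialForm A Q β) (hQ : 1 ≤ Q) (hβ : 0 ≤ β)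
    {w : ℂ} (hre : 0 ≤ w.re) (him : 2 * Q * (w.re + (β + 1)) < |w.im|) :
    IsBoundedBelowAt A w (1 / (4 * (1 + Q)) * (1 + ‖w‖)) := by
  intro x z hxz
  have hw : 1 + ‖w‖ ≤ 4 * (|w.im| - Q * (w.re + β)) := by
    have hnorm := Complex.norm_le_abs_re_add_abs_im w
    rw [abs_of_nonneg hre] at hnorm
    nlinarith [mul_nonneg (sub_nonneg.2 hQ) (add_nonneg hre hβ)]
  have hlow := hA.abs_im_sub_mul_norm_le (zero_le_one.trans hQ) w hxz
  rw [mul_assoc, one_div_mul_eq_div, div_le_iff₀' (by positivity)]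
  calc (1 + ‖w‖) * ‖x‖ ≤ 4 * (|w.im| - Q * (w.re + β)) * ‖x‖ := by gcongr
    _ ≤ 4 * (1 + Q) * ‖z - w • x‖ := by linarith

end HasSectorialForm

/-- For `Re w ≤ 0` accretivity controls `|Re w|` and sectoriality controls the rest. -/
theorem IsMAccretive.isBoundedBelowAt_of_le_norm {Q β r : ℝ} {w : ℂ} (hA : IsMAccretive A)
    (hAs : HasSectorialForm A Q β) (hQ : 0 ≤ Q) (hr : 0 ≤ r) (hre : w.re ≤ r)
    (hw : 2 * (2 * (1 + Q) * r + Q * β) + 1 ≤ ‖w‖) :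
    IsBoundedBelowAt A w (1 / (4 * (1 + Q)) * (1 + ‖w‖)) := by
  intro x z hxz
  have hsum : 1 + ‖w‖ ≤ 2 * ((|w.im| - Q * (w.re + β)) + (1 + Q) * -w.re) := by
    have hnorm := Complex.norm_le_abs_re_add_abs_im w
    rcases le_total 0 w.re with h | h
    · rw [abs_of_nonneg h] at hnorm
      nlinarith [mul_le_mul_of_nonneg_left hre hQ]
    · rw [abs_of_nonpos h] at hnorm
      nlinarith [mul_nonneg hQ (neg_nonneg.2 h), mul_nonneg hQ hr]
  have hlow := hAs.abs_im_sub_mul_norm_le hQ w hxz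
  have hacc := mul_le_mul_of_nonneg_left (hA.isBoundedBelowAt w hxz) (by positivity : 0 ≤ 1 + Q)
  rw [mul_assoc, one_div_mul_eq_div, div_le_iff₀' (by positivity)]
  calc (1 + ‖w‖) * ‖x‖ ≤ 2 * ((|w.im| - Q * (w.re + β)) + (1 + Q) * -w.re) * ‖x‖ := by gcongr
    _ ≤ 4 * (1 + Q) * ‖z - w • x‖ := by linarith

theorem HasSectorialForm.ampliation (ι : Type*) {Q β : ℝ} (hA : HasSectorialForm A Q β) :
    HasSectorialForm (ampliation ι A) Q β := by
  intro x z hxz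
  have hinner := lp.hasSum_inner (𝕜 := ℂ) x z
  have him := Complex.hasSum_im hinner
  have hform := ((Complex.hasSum_re hinner).add ((hasSum_norm_sq x).mul_left β)).mul_left Q
  have hsite i := abs_le.1 (hA ((mem_ampliation_graph A x z).1 hxz i))
  exact abs_le.2 ⟨hasSum_le (fun i => (hsite i).1) hform.neg him,
    hasSum_le (fun i => (hsite i).2) him hform⟩

end Accretive

/-! ### Generators of contraction semigroups -/

/-- A strongly continuous semigroup of contractions. -/
structure IsContractionSemigroup {E : Type*} [NormedAddCommGroup E] [NormedSpace ℂ E]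
    (S : ℝ≥0 → E →L[ℂ] E) : Prop where
  map_zero : ∀ x, S 0 x = x
  map_add : ∀ s t x, S (s + t) x = S s (S t x)
  norm_le : ∀ t x, ‖S t x‖ ≤ ‖x‖
  tendsto : ∀ x, Tendsto (fun t => S t x) (𝓝[>] 0) (𝓝 x)

section Laplace

variable {E : Type*} [NormedAddCommGroup E] [NormedSpace ℂ E] {S : ℝ≥0 → E →L[ℂ] E}

theorem mem_generator_graph_of_hasDerivAt {u : ℝ → E} {x z : E} (hu : ∀ t : ℝ≥0, u t = S t x)
    (hu₀ : u 0 = x) (hderiv : HasDerivAt u (-z) 0) : (x, z) ∈ (generator S).graph := by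
  have hcoe : Tendsto ((↑) : ℝ≥0 → ℝ) (𝓝[>] 0) (𝓝[>] 0) :=
    tendsto_nhdsWithin_iff.2 ⟨(NNReal.continuous_coe.tendsto' 0 0 rfl).mono_left nhdsWithin_le_nhds,
      eventually_mem_nhdsWithin.mono fun t ht => NNReal.coe_pos.2 ht⟩
  rw [mem_generator_graph, ← neg_neg z]
  refine (hderiv.tendsto_slope_zero_right.neg.comp hcoe).congr fun t => ?_
  rw [Function.comp_apply, zero_add, hu, hu₀, ← smul_neg, neg_sub, ← Complex.ofReal_inv,
    Complex.coe_smul]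

/-- The integrand `s ↦ e^{-as} S_s x` of the Laplace transform of `S`. -/
def laplaceIntegrand (S : ℝ≥0 → E →L[ℂ] E) (a : ℝ) (x : E) (s : ℝ) : E :=
  ((Real.exp (-a * s) : ℝ) : ℂ) • S s.toNNReal x

namespace IsContractionSemigroup

theorem norm_sub_le_nndist (hS : IsContractionSemigroup S) (x : E) (s t : ℝ≥0) :
    ‖S s x - S t x‖ ≤ ‖S (nndist s t) x - x‖ := by
  wlog h : t ≤ s generalizing s t
  · rw [norm_sub_rev, nndist_comm]
    exact this t s (le_of_not_ge h)
  have hs : s = t + nndist s t := by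
    rw [NNReal.nndist_eq, tsub_eq_zero_of_le h, max_eq_left zero_le, add_tsub_cancel_of_le h]
  nth_rewrite 1 [hs]
  rw [hS.map_add, ← map_sub]
  exact hS.norm_le _ _

theorem tendsto_nhds_zero (hS : IsContractionSemigroup S) (x : E) :
    Tendsto (fun t => S t x) (𝓝 0) (𝓝 x) := by
  have hzero : Tendsto (fun t => S t x) (pure 0) (𝓝 x) := by
    have h := tendsto_pure_nhds (fun t => S t x) 0
    rwa [hS.map_zero] at h
  have hnhds : 𝓝 (0 : ℝ≥0) = pure 0 ⊔ 𝓝[>] 0 := by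
    rw [← nhdsWithin_insert, Set.Ioi_insert, ← bot_eq_zero, Set.Ici_bot, nhdsWithin_univ]
  rw [hnhds]
  exact hzero.sup (hS.tendsto x)

theorem continuous (hS : IsContractionSemigroup S) (x : E) : Continuous fun t => S t x := by
  refine continuous_iff_continuousAt.2 fun t => tendsto_iff_norm_sub_tendsto_zero.2 ?_
  refine squeeze_zero (fun _ => norm_nonneg _) (fun s => hS.norm_sub_le_nndist x s t) ?_
  have hdist : Tendsto (fun s => nndist s t) (𝓝 t) (𝓝 0) :=
    (by fun_prop : Continuous fun s => nndist s t).tendsto' t 0 (nndist_self t)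
  exact (tendsto_iff_norm_sub_tendsto_zero.1 (hS.tendsto_nhds_zero x)).comp hdist

theorem continuous_laplaceIntegrand (hS : IsContractionSemigroup S) (a : ℝ) (x : E) :
    Continuous (laplaceIntegrand S a x) :=
  (by fun_prop : Continuous fun s : ℝ => ((Real.exp (-a * s) : ℝ) : ℂ)).smul
    ((hS.continuous x).comp continuous_real_toNNReal)

theorem norm_laplaceIntegrand_le (hS : IsContractionSemigroup S) (a : ℝ) (x : E) (s : ℝ) :
    ‖laplaceIntegrand S a x s‖ ≤ Real.exp (-a * s) * ‖x‖ := by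
  rw [laplaceIntegrand, norm_smul, Complex.norm_real, Real.norm_of_nonneg (Real.exp_pos _).le]
  exact mul_le_mul_of_nonneg_left (hS.norm_le _ _) (Real.exp_pos _).le

theorem integrableOn_laplaceIntegrand (hS : IsContractionSemigroup S) {a : ℝ} (ha : 0 < a) (x : E) :
    IntegrableOn (laplaceIntegrand S a x) (Set.Ioi 0) :=
  ((exp_neg_integrableOn_Ioi 0 ha).mul_const ‖x‖).mono'
    (hS.continuous_laplaceIntegrand a x).aestronglyMeasurable
    (ae_of_all _ (hS.norm_laplaceIntegrand_le a x))

/-- The Laplace transform `∫₀^∞ e^{-as} S_s ds` of a contraction semigroup, for `a > 0`. -/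
def laplace (hS : IsContractionSemigroup S) {a : ℝ} (ha : 0 < a) : E →L[ℂ] E :=
  LinearMap.mkContinuous
    { toFun := fun x => ∫ s in Set.Ioi 0, laplaceIntegrand S a x s
      map_add' := fun x y => by
        rw [← integral_add (hS.integrableOn_laplaceIntegrand ha x)
          (hS.integrableOn_laplaceIntegrand ha y)]
        simp only [laplaceIntegrand, _root_.map_add, smul_add]
      map_smul' := fun c x => by
        rw [RingHom.id_apply, ← integral_smul]
        simp only [laplaceIntegrand, map_smul, smul_comm c] }
    (1 / a) (fun x => by
      refine (norm_integral_le_of_norm_le ((exp_neg_integrableOn_Ioi 0 ha).mul_const ‖x‖)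
        (ae_of_all _ (hS.norm_laplaceIntegrand_le a x))).trans_eq ?_
      rw [integral_mul_const, integral_exp_mul_Ioi (neg_lt_zero.2 ha), mul_zero, Real.exp_zero,
        neg_div_neg_eq])

theorem laplace_apply (hS : IsContractionSemigroup S) {a : ℝ} (ha : 0 < a) (x : E) :
    hS.laplace ha x = ∫ s in Set.Ioi 0, laplaceIntegrand S a x s := rfl

theorem apply_laplaceIntegrand (hS : IsContractionSemigroup S) (a : ℝ) (x : E) (t : ℝ≥0) {s : ℝ}
    (hs : 0 ≤ s) :
    S t (laplaceIntegrand S a x s) =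
      ((Real.exp (a * t) : ℝ) : ℂ) • laplaceIntegrand S a x (s + t) := by
  have hexp : Real.exp (-a * s) = Real.exp (a * t) * Real.exp (-a * (s + t)) := by
    rw [← Real.exp_add]; ring_nf
  rw [laplaceIntegrand, laplaceIntegrand, map_smul, smul_smul, ← hS.map_add,
    Real.toNNReal_add hs t.coe_nonneg, Real.toNNReal_coe, add_comm t, hexp, Complex.ofReal_mul]

variable [CompleteSpace E]

theorem apply_laplace (hS : IsContractionSemigroup S) {a : ℝ} (ha : 0 < a) (x : E) (t : ℝ≥0) :
    S t (hS.laplace ha x) = ((Real.exp (a * t) : ℝ) : ℂ) •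
      (hS.laplace ha x - ∫ s in (0 : ℝ)..t, laplaceIntegrand S a x s) := by
  have hint := hS.integrableOn_laplaceIntegrand ha x
  have htail : ∫ s in Set.Ioi (0 : ℝ), laplaceIntegrand S a x (s + t) =
      ∫ s in Set.Ioi (t : ℝ), laplaceIntegrand S a x s := by
    simpa using (measurePreserving_add_right volume (t : ℝ)).setIntegral_preimage_emb
      (measurableEmbedding_addRight _) (laplaceIntegrand S a x) (Set.Ioi (t : ℝ))
  rw [laplace_apply, ← intervalIntegral.integral_Ioi_sub_Ioi hint t.coe_nonneg, sub_sub_cancel,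
    ← ContinuousLinearMap.integral_comp_comm _ hint, ← htail, ← integral_smul]
  exact setIntegral_congr_fun measurableSet_Ioi fun s hs =>
    hS.apply_laplaceIntegrand a x t (le_of_lt hs)

theorem laplace_mem_graph (hS : IsContractionSemigroup S) {a : ℝ} (ha : 0 < a) (x : E) :
    (hS.laplace ha x, x + (-a : ℂ) • hS.laplace ha x) ∈ (generator S).graph := by
  have hint : HasDerivAt (fun t => ∫ s in (0 : ℝ)..t, laplaceIntegrand S a x s) x 0 := by
    have hc := hS.continuous_laplaceIntegrand a x
    simpa [laplaceIntegrand, hS.map_zero] using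
      intervalIntegral.integral_hasDerivAt_right (hc.intervalIntegrable 0 0)
        (hc.stronglyMeasurableAtFilter _ _) hc.continuousAt
  have hexp : HasDerivAt (fun t : ℝ => ((Real.exp (a * t) : ℝ) : ℂ)) (a : ℂ) 0 := by
    simpa using ((hasDerivAt_id (0 : ℝ)).const_mul a).exp.ofReal_comp
  refine mem_generator_graph_of_hasDerivAt (u := fun t : ℝ => ((Real.exp (a * t) : ℝ) : ℂ) •
    (hS.laplace ha x - ∫ s in (0 : ℝ)..t, laplaceIntegrand S a x s))
    (fun t => (hS.apply_laplace ha x t).symm) (by simp) ?_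
  have h := hexp.smul (hint.const_sub (hS.laplace ha x))
  simp only [mul_zero, Real.exp_zero, Complex.ofReal_one, one_smul,
    intervalIntegral.integral_same, sub_zero] at h
  refine h.congr_deriv ?_
  module

end IsContractionSemigroup

end Laplace

namespace IsContractionSemigroup

variable {E : Type*} [NormedAddCommGroup E] [InnerProductSpace ℂ E] {S : ℝ≥0 → E →L[ℂ] E}

theorem re_inner_generator_nonneg (hS : IsContractionSemigroup S) {x z : E}
    (h : (x, z) ∈ (generator S).graph) : 0 ≤ (⟪x, z⟫_ℂ).re := by
  have hlim := (Complex.continuous_re.tendsto _).comp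
    ((tendsto_const_nhds (x := x)).inner ((mem_generator_graph S x z).1 h))
  refine ge_of_tendsto' hlim fun t => ?_
  rw [Function.comp_apply, inner_smul_right, ← Complex.ofReal_inv, Complex.re_ofReal_mul,
    inner_sub_right, Complex.sub_re]
  refine mul_nonneg (by positivity) (sub_nonneg.2 ?_)
  calc (⟪x, S t x⟫_ℂ).re ≤ ‖x‖ * ‖S t x‖ := re_inner_le_norm (𝕜 := ℂ) x _
    _ ≤ ‖x‖ * ‖x‖ := by gcongr; exact hS.norm_le _ _
    _ = (⟪x, x⟫_ℂ).re := (inner_self_eq_norm_mul_norm (𝕜 := ℂ) x).symm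

theorem isMAccretive_generator [CompleteSpace E] (hS : IsContractionSemigroup S) :
    IsMAccretive (generator S) where
  re_inner_nonneg _ _ h := hS.re_inner_generator_nonneg h
  exists_isResolvent_neg := by
    have hbelow : IsBoundedBelowAt (generator S) (-(1 : ℝ) : ℂ) 1 := fun x z h => by
      simpa using sub_re_mul_norm_le_norm_sub_smul (a := 0) (-(1 : ℝ) : ℂ)
        ((zero_mul _).trans_le (hS.re_inner_generator_nonneg h))
    exact ⟨1, one_pos, _,
      hbelow.isResolvent_of_mem_graph one_pos (hS.laplace_mem_graph one_pos)⟩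

end IsContractionSemigroup

/-! ### Indicators in `L²` -/

section Indicators

variable {α : Type*} [m : MeasurableSpace α] {ν : Measure α} [IsFiniteMeasure ν]
  {W : Submodule ℂ (Lp ℂ 2 ν)}

/-- The indicator function of a measurable set as an element of `L²` of a finite measure. -/
def indL2 (ν : Measure α) [IsFiniteMeasure ν] {A : Set α} (hA : MeasurableSet A) : Lp ℂ 2 ν :=
  indicatorConstLp 2 hA (measure_ne_top ν A) 1

theorem indL2_empty : indL2 ν MeasurableSet.empty = 0 := indicatorConstLp_empty

theorem indL2_union {A C : Set α} (hA : MeasurableSet A) (hC : MeasurableSet C)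
    (hAC : Disjoint A C) : indL2 ν (hA.union hC) = indL2 ν hA + indL2 ν hC :=
  indicatorConstLp_disjoint_union hA hC (measure_ne_top _ _) (measure_ne_top _ _) hAC 1

theorem indL2_compl {A : Set α} (hA : MeasurableSet A) :
    indL2 ν hA.compl = Lp.const 2 ν 1 - indL2 ν hA := by
  rw [eq_sub_iff_add_eq', ← indL2_union hA hA.compl disjoint_compl_right, ← indicatorConstLp_univ]
  simp only [indL2, Set.union_compl_self]

theorem indicatorConstLp_eq_smul_indL2 (c : ℂ) {A : Set α} (hA : MeasurableSet A) :
    indicatorConstLp 2 hA (measure_ne_top ν A) c = c • indL2 ν hA := by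
  rw [indL2, indicatorConstLp, indicatorConstLp, ← MemLp.toLp_const_smul]
  congr 1
  ext x
  by_cases hx : x ∈ A <;> simp [hx]

theorem mem_of_forall_indL2_mem (hW : IsClosed (W : Set (Lp ℂ 2 ν)))
    (h : ∀ (A : Set α) (hA : MeasurableSet A), indL2 ν hA ∈ W) (f : Lp ℂ 2 ν) : f ∈ W := by
  refine Lp.induction (by simp) (motive := (· ∈ W)) (fun c A hA _ => ?_)
    (fun _ _ _ _ _ hf hg => W.add_mem hf hg) hW f
  rw [Lp.simpleFunc.coe_indicatorConst, indicatorConstLp_eq_smul_indL2]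
  exact W.smul_mem c (h A hA)

theorem ext_inner_indL2 {u v : Lp ℂ 2 ν}
    (h : ∀ (A : Set α) (hA : MeasurableSet A), ⟪indL2 ν hA, u⟫_ℂ = ⟪indL2 ν hA, v⟫_ℂ) : u = v := by
  have hmem : u - v ∈ (ℂ ∙ (u - v))ᗮ :=
    mem_of_forall_indL2_mem (Submodule.isClosed_orthogonal _) (fun A hA => by
      rw [Submodule.mem_orthogonal_singleton_iff_inner_left, inner_sub_right, h, sub_self]) _
  rwa [Submodule.mem_orthogonal_singleton_iff_inner_left, inner_self_eq_zero, sub_eq_zero] at hmem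

theorem tendsto_indL2_accumulate {f : ℕ → Set α} (hf : ∀ n, MeasurableSet (f n))
    (hdisj : Pairwise (Function.onFun Disjoint f))
    (hacc : ∀ n, MeasurableSet (Set.accumulate f n)) :
    Tendsto (fun n => indL2 ν (hacc n)) atTop (𝓝 (indL2 ν (.iUnion hf))) := by
  refine tendsto_indicatorConstLp_set (by simp) ?_
  have htail : Tendsto (fun n => ν (⋃ i ≥ n, f i)) atTop (𝓝 0) :=
    tendsto_measure_biUnion_Ici_zero_of_pairwise_disjoint
      (fun n => (hf n).nullMeasurableSet) hdisj
  refine tendsto_of_tendsto_of_tendsto_of_le_of_le tendsto_const_nhds htail (fun _ => zero_le)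
    fun n => measure_mono ?_
  rw [symmDiff_of_le (Set.accumulate_subset_iUnion n)]
  rintro x ⟨hx, hxn⟩
  obtain ⟨i, hi⟩ := Set.mem_iUnion.1 hx
  exact Set.mem_iUnion₂.2
    ⟨i, (not_le.1 fun hin => hxn (Set.mem_accumulate.2 ⟨i, hin, hi⟩)).le, hi⟩

theorem indL2_iUnion_mem (hW : IsClosed (W : Set (Lp ℂ 2 ν))) {f : ℕ → Set α}
    (hdisj : Pairwise (Function.onFun Disjoint f)) (hf : ∀ n, MeasurableSet (f n))
    (hmem : ∀ n, indL2 ν (hf n) ∈ W) : indL2 ν (.iUnion hf) ∈ W := by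
  have hacc : ∀ n, MeasurableSet (Set.accumulate f n) := fun n => .biUnion (Set.to_countable _)
    fun i _ => hf i
  refine hW.mem_of_tendsto (tendsto_indL2_accumulate hf hdisj hacc) (.of_forall fun n => ?_)
  rw [SetLike.mem_coe]
  induction n with
  | zero => simpa only [Set.accumulate_zero_nat] using hmem 0
  | succ n ih =>
    simp only [Set.accumulate_succ]
    rw [indL2_union (hacc n) (hf (n + 1)) (Set.disjoint_accumulate hdisj n.lt_succ_self)]
    exact W.add_mem ih (hmem (n + 1))

theorem indL2_mem_of_isPiSystem (hW : IsClosed (W : Set (Lp ℂ 2 ν))) {s : Set (Set α)}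
    (hs : m = MeasurableSpace.generateFrom s) (hpi : IsPiSystem s)
    (hconst : Lp.const 2 ν (1 : ℂ) ∈ W)
    (h : ∀ (A : Set α) (hA : MeasurableSet A), A ∈ s → indL2 ν hA ∈ W) (A : Set α)
    (hA : MeasurableSet A) : indL2 ν hA ∈ W := by
  refine MeasurableSpace.induction_on_inter (C := fun A hA => indL2 ν hA ∈ W) hs hpi
    (indL2_empty (ν := ν) ▸ W.zero_mem) (fun A hA => h A _ hA) (fun A hA hmem => ?_)
    (fun f hdisj hf => indL2_iUnion_mem hW hdisj hf) A hA
  rw [indL2_compl hA]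
  exact W.sub_mem hconst hmem

end Indicators

/-! ### The semigroup of the environment -/

theorem isClosed_setOf_tendsto_apply {ι E F : Type*} [NormedAddCommGroup E] [NormedSpace ℂ E]
    [NormedAddCommGroup F] [NormedSpace ℂ F] {S : ι → E →L[ℂ] F} (hS : ∀ i x, ‖S i x‖ ≤ ‖x‖)
    (S₀ : E →L[ℂ] F) (l : Filter ι) : IsClosed {x | Tendsto (fun i => S i x) l (𝓝 (S₀ x))} := by
  have hlip : ∀ i, LipschitzWith 1 (S i) := fun i =>
    AddMonoidHomClass.lipschitz_of_bound_nnnorm (S i) 1 fun x => by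
      rw [one_mul]
      exact hS i x
  exact (LipschitzWith.uniformEquicontinuous _ 1 hlip).equicontinuous.isClosed_setOfPred_tendsto
    S₀.continuous

theorem measurableSet_eval_mem {Ω : Type*} [MeasurableSpace Ω] (t : ℝ≥0) {A : Set Ω}
    (hA : MeasurableSet A) : MeasurableSet {ω : ℝ≥0 → Ω | ω t ∈ A} :=
  measurable_pi_apply t hA

namespace Environment

variable {d : ℕ} {Ω : Type*} [MeasurableSpace Ω] {μ : Measure Ω} [TopologicalSpace Ω]

section PathLaw

variable (X : Environment d μ)

theorem ae_of_forall_rightContinuous {a : Ω} {p : (ℝ≥0 → Ω) → Prop}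
    (hp : MeasurableSet {ω | p ω})
    (h : ∀ ω : ℝ≥0 → Ω, (∀ t, ContinuousWithinAt ω (Set.Ici t) t) → ω 0 = a → p ω) :
    ∀ᵐ ω ∂(X.P a), p ω := by
  have := X.isMarkov
  rw [ae_iff]
  change X.P a {ω | p ω}ᶜ = 0
  rw [prob_compl_eq_zero_iff hp]
  refine le_antisymm prob_le_one ?_
  rw [← X.right_cont a]
  exact measure_mono fun ω hω => h ω hω.1 hω.2

theorem setLIntegral_pathLaw {C : Set Ω} (hC : MeasurableSet C) {F : (ℝ≥0 → Ω) → ℝ≥0∞}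
    (hF : Measurable F) :
    ∫⁻ ω in {ω | ω 0 ∈ C}, F ω ∂X.pathLaw = ∫⁻ a in C, ∫⁻ ω, F ω ∂(X.P a) ∂μ := by
  have hm : MeasurableSet {ω : ℝ≥0 → Ω | ω 0 ∈ C} := measurableSet_eval_mem 0 hC
  rw [← lintegral_indicator hm, pathLaw, Measure.lintegral_bind X.P.measurable.aemeasurable
    (hF.indicator hm).aemeasurable, ← lintegral_indicator hC]
  refine lintegral_congr fun a => ?_
  by_cases ha : a ∈ C
  · rw [Set.indicator_of_mem ha]
    refine lintegral_congr_ae ?_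
    filter_upwards [X.ae_of_forall_rightContinuous (a := a) hm fun ω _ h => h ▸ ha] with ω hω
    exact Set.indicator_of_mem (s := {ω : ℝ≥0 → Ω | ω 0 ∈ C}) hω F
  · rw [Set.indicator_of_notMem ha, ← lintegral_zero (μ := X.P a)]
    refine lintegral_congr_ae ?_
    filter_upwards [X.ae_of_forall_rightContinuous (a := a) (p := fun ω => ω 0 ∉ C) hm.compl
      fun ω _ h => h ▸ ha] with ω hω
    exact Set.indicator_of_notMem (s := {ω : ℝ≥0 → Ω | ω 0 ∈ C}) hω F

theorem pathLaw_inter {C : Set Ω} (hC : MeasurableSet C) {D : Set (ℝ≥0 → Ω)}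
    (hD : MeasurableSet D) :
    X.pathLaw ({ω | ω 0 ∈ C} ∩ D) = ∫⁻ a in C, X.P a D ∂μ := by
  have h := X.setLIntegral_pathLaw hC (F := D.indicator 1) (measurable_one.indicator hD)
  rw [lintegral_indicator_one hD, Measure.restrict_apply hD, Set.inter_comm] at h
  rw [h]
  exact lintegral_congr fun a => lintegral_indicator_one hD

theorem norm_evalL2 (t : ℝ≥0) (f : Lp ℂ 2 μ) : ‖X.evalL2 t f‖ = ‖f‖ :=
  LinearIsometry.norm_map _ f

theorem inner_evalL2 (t : ℝ≥0) (f g : Lp ℂ 2 μ) : ⟪X.evalL2 t f, X.evalL2 t g⟫_ℂ = ⟪f, g⟫_ℂ :=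
  LinearIsometry.inner_map_map _ f g

theorem adjoint_evalL2_evalL2 (t : ℝ≥0) (f : Lp ℂ 2 μ) :
    (X.evalL2 t).adjoint (X.evalL2 t f) = f :=
  ext_inner_left ℂ fun g => by rw [ContinuousLinearMap.adjoint_inner_right, inner_evalL2]

theorem norm_adjoint_evalL2_le (t : ℝ≥0) (f : Lp ℂ 2 X.pathLaw) :
    ‖(X.evalL2 t).adjoint f‖ ≤ ‖f‖ := by
  refine (ContinuousLinearMap.le_of_opNorm_le _ (c := 1) ?_ f).trans (one_mul _).le
  rw [LinearIsometryEquiv.norm_map]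
  exact LinearIsometry.norm_toContinuousLinearMap_le _

theorem adjSemigroup_apply (t : ℝ≥0) (f : Lp ℂ 2 μ) :
    X.adjSemigroup t f = (X.evalL2 t).adjoint (X.evalL2 0 f) := rfl

/-- The forward semigroup `S_t f(a) = E_a f(ω_t)` on `L²(Ω, μ)`. -/
def fwdSemigroup (t : ℝ≥0) : Lp ℂ 2 μ →L[ℂ] Lp ℂ 2 μ :=
  (X.evalL2 0).adjoint.comp (X.evalL2 t)

theorem inner_fwdSemigroup (t : ℝ≥0) (f g : Lp ℂ 2 μ) :
    ⟪g, X.fwdSemigroup t f⟫_ℂ = ⟪X.evalL2 0 g, X.evalL2 t f⟫_ℂ :=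
  ContinuousLinearMap.adjoint_inner_right (X.evalL2 0) g (X.evalL2 t f)

theorem fwdSemigroup_zero (f : Lp ℂ 2 μ) : X.fwdSemigroup 0 f = f := X.adjoint_evalL2_evalL2 0 f

theorem adjoint_fwdSemigroup (t : ℝ≥0) : (X.fwdSemigroup t).adjoint = X.adjSemigroup t := by
  rw [fwdSemigroup, adjSemigroup, ContinuousLinearMap.adjoint_comp,
    ContinuousLinearMap.adjoint_adjoint]

theorem ae_eventually_mem_of_isOpen [OpensMeasurableSpace Ω] {U : Set Ω} (hU : IsOpen U) {a : Ω}
    (ha : a ∈ U) {u : ℕ → ℝ≥0} (hu : Tendsto u atTop (𝓝[>] 0)) :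
    ∀ᵐ ω ∂(X.P a), ∀ᶠ n in atTop, ω (u n) ∈ U := by
  have hm : MeasurableSet {ω : ℝ≥0 → Ω | ∀ᶠ n in atTop, ω (u n) ∈ U} := by
    convert MeasurableSet.measurableSet_liminf fun n =>
      measurableSet_eval_mem (u n) hU.measurableSet
    ext ω
    simp only [mem_liminf_iff_eventually_mem, Set.mem_ofPred_eq]
  refine X.ae_of_forall_rightContinuous hm fun ω hω h₀ => ?_
  have hcont : Tendsto ω (𝓝[>] 0) (𝓝 (ω 0)) :=
    (hω 0).mono_left (nhdsWithin_mono _ Set.Ioi_subset_Ici_self)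
  exact (hcont.comp hu).eventually (hU.mem_nhds (h₀ ▸ ha))

theorem tendsto_prob_notMem_of_isOpen [OpensMeasurableSpace Ω] {U : Set Ω} (hU : IsOpen U) {a : Ω}
    (ha : a ∈ U) : Tendsto (fun t : ℝ≥0 => X.P a {ω | ω t ∉ U}) (𝓝[>] 0) (𝓝 0) := by
  have := X.isMarkov
  refine tendsto_of_seq_tendsto fun u hu => ?_
  rw [← measure_empty (μ := X.P a)]
  refine tendsto_measure_of_ae_tendsto_indicator_of_isFiniteMeasure atTop MeasurableSet.empty
    (fun n => (measurableSet_eval_mem (u n) hU.measurableSet).compl) ?_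
  filter_upwards [X.ae_eventually_mem_of_isOpen hU ha hu] with ω hω
  filter_upwards [hω] with n hn
  exact iff_of_false (not_not_intro hn) (Set.notMem_empty ω)

end PathLaw

section FiniteMeasure

variable [IsFiniteMeasure μ] (X : Environment d μ)

instance : IsFiniteMeasure X.pathLaw :=
  ⟨((X.eval_preserving 0).measure_preimage MeasurableSet.univ.nullMeasurableSet).trans_lt
    (measure_lt_top μ _)⟩

theorem evalL2_indL2 (t : ℝ≥0) {A : Set Ω} (hA : MeasurableSet A) :
    X.evalL2 t (indL2 μ hA) = indL2 X.pathLaw (measurableSet_eval_mem t hA) :=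
  rfl

theorem evalL2_const (t : ℝ≥0) (c : ℂ) :
    X.evalL2 t (Lp.const 2 μ c) = Lp.const 2 X.pathLaw c := rfl

theorem tendsto_pathLaw_exit [OpensMeasurableSpace Ω] {U : Set Ω} (hU : IsOpen U) :
    Tendsto (fun t : ℝ≥0 => X.pathLaw ({ω | ω 0 ∈ U} \ {ω | ω t ∈ U})) (𝓝[>] 0) (𝓝 0) := by
  have := X.isMarkov
  have hm : ∀ t : ℝ≥0, MeasurableSet {ω : ℝ≥0 → Ω | ω t ∉ U} := fun t =>
    (measurableSet_eval_mem t hU.measurableSet).compl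
  have h : Tendsto (fun t : ℝ≥0 => ∫⁻ a in U, X.P a {ω | ω t ∉ U} ∂μ) (𝓝[>] 0)
      (𝓝 (∫⁻ _ in U, 0 ∂μ)) := by
    refine tendsto_lintegral_filter_of_dominated_convergence (fun _ => 1)
      (.of_forall fun t => X.P.measurable_coe (hm t))
      (.of_forall fun t => ae_of_all _ fun a => prob_le_one) (by simp) ?_
    exact ae_restrict_of_forall_mem hU.measurableSet fun a ha =>
      X.tendsto_prob_notMem_of_isOpen hU ha
  rw [lintegral_zero] at h
  exact h.congr fun t => (X.pathLaw_inter hU.measurableSet (hm t)).symm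

theorem pathLaw_symmDiff_le {A : Set Ω} (hA : MeasurableSet A) (s t : ℝ≥0) :
    X.pathLaw (symmDiff {ω | ω t ∈ A} {ω | ω s ∈ A}) ≤
      2 * X.pathLaw ({ω | ω s ∈ A} \ {ω | ω t ∈ A}) := by
  have heval : ∀ r : ℝ≥0, X.pathLaw {ω | ω r ∈ A} = μ A := fun r =>
    (X.eval_preserving r).measure_preimage hA.nullMeasurableSet
  have heq : X.pathLaw ({ω | ω t ∈ A} \ {ω | ω s ∈ A}) =
      X.pathLaw ({ω | ω s ∈ A} \ {ω | ω t ∈ A}) := by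
    rw [measure_sdiff' _ (measurableSet_eval_mem s hA).nullMeasurableSet (measure_ne_top _ _),
      measure_sdiff' _ (measurableSet_eval_mem t hA).nullMeasurableSet (measure_ne_top _ _),
      heval, heval, Set.union_comm]
  rw [two_mul]
  exact (measure_union_le _ _).trans (add_le_add heq.le le_rfl)

theorem tendsto_evalL2_indL2_of_isOpen [OpensMeasurableSpace Ω] {U : Set Ω} (hU : IsOpen U) :
    Tendsto (fun t => X.evalL2 t (indL2 μ hU.measurableSet)) (𝓝[>] 0)
      (𝓝 (X.evalL2 0 (indL2 μ hU.measurableSet))) := by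
  simp only [evalL2_indL2]
  refine tendsto_indicatorConstLp_set (by simp) ?_
  have hexit := ENNReal.Tendsto.const_mul (a := 2) (X.tendsto_pathLaw_exit hU)
    (.inr ENNReal.ofNat_ne_top)
  rw [mul_zero] at hexit
  exact tendsto_of_tendsto_of_tendsto_of_le_of_le tendsto_const_nhds hexit (fun _ => zero_le)
    (X.pathLaw_symmDiff_le hU.measurableSet 0)

theorem tendsto_evalL2 [BorelSpace Ω] (f : Lp ℂ 2 μ) :
    Tendsto (fun t => X.evalL2 t f) (𝓝[>] 0) (𝓝 (X.evalL2 0 f)) := by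
  let W : Submodule ℂ (Lp ℂ 2 μ) :=
    { carrier := {f | Tendsto (fun t => X.evalL2 t f) (𝓝[>] 0) (𝓝 (X.evalL2 0 f))}
      zero_mem' := by
        simp only [Set.mem_ofPred_eq, map_zero]
        exact tendsto_const_nhds
      add_mem' := fun {f g} hf hg => by
        simp only [Set.mem_ofPred_eq, map_add] at hf hg ⊢
        exact hf.add hg
      smul_mem' := fun c f hf => by
        simp only [Set.mem_ofPred_eq, map_smul] at hf ⊢
        exact hf.const_smul c }
  have hW : IsClosed (W : Set (Lp ℂ 2 μ)) :=
    isClosed_setOf_tendsto_apply (S := X.evalL2) (fun t f => (X.norm_evalL2 t f).le)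
      (X.evalL2 0) (𝓝[>] 0)
  have hconst : Lp.const 2 μ (1 : ℂ) ∈ W := tendsto_const_nhds
  exact mem_of_forall_indL2_mem hW (indL2_mem_of_isPiSystem hW (s := {s | IsOpen s})
    BorelSpace.measurable_eq isPiSystem_isOpen hconst
    fun U _ hU => X.tendsto_evalL2_indL2_of_isOpen hU) f

theorem memLp_transition (t : ℝ≥0) {A : Set Ω} (hA : MeasurableSet A) :
    MemLp (fun a => ((X.P a).real {ω | ω t ∈ A} : ℂ)) 2 μ := by
  have := X.isMarkov
  have hm := (X.P.measurable_coe (measurableSet_eval_mem t hA)).ennreal_toReal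
  refine .of_bound hm.complex_ofReal.aestronglyMeasurable 1 (ae_of_all _ fun a => ?_)
  rw [Complex.norm_real, Real.norm_of_nonneg measureReal_nonneg]
  exact measureReal_le_one

/-- The transition probability `a ↦ P_a(ω_t ∈ A)` as an element of `L²(Ω, μ)`. -/
def transition (t : ℝ≥0) {A : Set Ω} (hA : MeasurableSet A) : Lp ℂ 2 μ :=
  (X.memLp_transition t hA).toLp _

theorem evalL2_transition_ae_eq (s t : ℝ≥0) {A : Set Ω} (hA : MeasurableSet A) :
    X.evalL2 s (X.transition t hA) =ᵐ[X.pathLaw]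
      fun ω => ((X.P (ω s)).real {ω | ω t ∈ A} : ℂ) :=
  (Lp.coeFn_compMeasurePreserving _ (X.eval_preserving s)).trans
    ((X.eval_preserving s).quasiMeasurePreserving.ae_eq_comp
      (X.memLp_transition t hA).coeFn_toLp)

theorem inner_evalL2_transition (s t : ℝ≥0) {A C : Set Ω} (hA : MeasurableSet A)
    (hC : MeasurableSet C) :
    ⟪X.evalL2 0 (indL2 μ hC), X.evalL2 s (X.transition t hA)⟫_ℂ =
      ((∫⁻ a in C, ∫⁻ ω, X.P (ω s) {ω | ω t ∈ A} ∂(X.P a) ∂μ).toReal : ℂ) := by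
  have := X.isMarkov
  have hF : Measurable fun ω : ℝ≥0 → Ω => X.P (ω s) {ω | ω t ∈ A} :=
    (X.P.measurable_coe (measurableSet_eval_mem t hA)).comp (measurable_pi_apply s)
  rw [evalL2_indL2, indL2, L2.inner_indicatorConstLp_one,
    ← X.setLIntegral_pathLaw hC hF, ← integral_toReal hF.aemeasurable
      (ae_of_all _ fun ω => measure_lt_top _ _), ← integral_complex_ofReal]
  exact integral_congr_ae (ae_restrict_of_ae (X.evalL2_transition_ae_eq s t hA))

theorem inner_fwdSemigroup_indL2 (t : ℝ≥0) {A C : Set Ω} (hA : MeasurableSet A)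
    (hC : MeasurableSet C) :
    ⟪indL2 μ hC, X.fwdSemigroup t (indL2 μ hA)⟫_ℂ =
      ((∫⁻ a in C, X.P a {ω | ω t ∈ A} ∂μ).toReal : ℂ) := by
  rw [inner_fwdSemigroup, evalL2_indL2, evalL2_indL2, indL2, indL2,
    L2.inner_indicatorConstLp_one_indicatorConstLp_one, Measure.real,
    ← X.pathLaw_inter hC (measurableSet_eval_mem t hA)]
  rfl

theorem fwdSemigroup_indL2 (t : ℝ≥0) {A : Set Ω} (hA : MeasurableSet A) :
    X.fwdSemigroup t (indL2 μ hA) = X.transition t hA := by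
  have := X.isMarkov
  refine ext_inner_indL2 fun C hC => ?_
  rw [X.inner_fwdSemigroup_indL2 t hA hC, ← X.inner_evalL2 0, X.inner_evalL2_transition 0 t hA hC]
  congr 2
  refine lintegral_congr fun a => ?_
  have hF : Measurable fun ω : ℝ≥0 → Ω => X.P (ω 0) {ω | ω t ∈ A} :=
    (X.P.measurable_coe (measurableSet_eval_mem t hA)).comp (measurable_pi_apply 0)
  have hstart : ∀ᵐ ω ∂(X.P a), X.P (ω 0) {ω | ω t ∈ A} = X.P a {ω | ω t ∈ A} :=
    X.ae_of_forall_rightContinuous (measurableSet_eq_fun hF measurable_const)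
      fun ω _ h => by rw [h]
  rw [lintegral_congr_ae hstart, lintegral_const, measure_univ, mul_one]

theorem fwdSemigroup_add (s t : ℝ≥0) (f : Lp ℂ 2 μ) :
    X.fwdSemigroup (s + t) f = X.fwdSemigroup s (X.fwdSemigroup t f) := by
  rcases eq_zero_or_pos s with rfl | hs
  · rw [zero_add, fwdSemigroup_zero]
  refine mem_of_forall_indL2_mem (W := LinearMap.eqLocus (X.fwdSemigroup (s + t)).toLinearMap
    (X.fwdSemigroup s ∘L X.fwdSemigroup t).toLinearMap)
    (isClosed_eq (X.fwdSemigroup (s + t)).continuous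
      (X.fwdSemigroup s ∘L X.fwdSemigroup t).continuous) (fun A hA => ?_) f
  change X.fwdSemigroup (s + t) (indL2 μ hA) = X.fwdSemigroup s (X.fwdSemigroup t (indL2 μ hA))
  refine ext_inner_indL2 fun C hC => ?_
  rw [X.inner_fwdSemigroup_indL2 _ hA hC, X.fwdSemigroup_indL2 t hA, inner_fwdSemigroup,
    X.inner_evalL2_transition s t hA hC]
  congr 2
  refine lintegral_congr fun a => ?_
  rw [← X.markov s hs _ (measurableSet_eval_mem t hA) a, add_comm s t]
  rfl

theorem isContractionSemigroup_adjSemigroup [BorelSpace Ω] :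
    IsContractionSemigroup X.adjSemigroup where
  map_zero f := X.adjoint_evalL2_evalL2 0 f
  map_add s t f := ext_inner_left ℂ fun g => by
    simp only [← adjoint_fwdSemigroup, ContinuousLinearMap.adjoint_inner_right]
    rw [← fwdSemigroup_add, add_comm]
  norm_le t f := (X.norm_adjoint_evalL2_le t _).trans (X.norm_evalL2 0 f).le
  tendsto f := by
    refine tendsto_iff_norm_sub_tendsto_zero.2 (squeeze_zero (fun _ => norm_nonneg _) (fun t => ?_)
      (tendsto_iff_norm_sub_tendsto_zero.1 (X.tendsto_evalL2 f)))
    calc ‖X.adjSemigroup t f - f‖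
        = ‖(X.evalL2 t).adjoint (X.evalL2 0 f - X.evalL2 t f)‖ := by
          rw [map_sub, X.adjoint_evalL2_evalL2, adjSemigroup_apply]
      _ ≤ ‖X.evalL2 0 f - X.evalL2 t f‖ := X.norm_adjoint_evalL2_le t _
      _ = ‖X.evalL2 t f - X.evalL2 0 f‖ := norm_sub_rev _ _

theorem adjSemigroup_const (t : ℝ≥0) (c : ℂ) :
    X.adjSemigroup t (Lp.const 2 μ c) = Lp.const 2 μ c := by
  rw [adjSemigroup_apply, evalL2_const, ← X.evalL2_const t, X.adjoint_evalL2_evalL2]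

theorem inner_const_adjSemigroup (t : ℝ≥0) (c : ℂ) (f : Lp ℂ 2 μ) :
    ⟪Lp.const 2 μ c, X.adjSemigroup t f⟫_ℂ = ⟪Lp.const 2 μ c, f⟫_ℂ := by
  rw [adjSemigroup_apply, ContinuousLinearMap.adjoint_inner_right, evalL2_const,
    ← X.evalL2_const 0, inner_evalL2]

theorem isMAccretive_B [BorelSpace Ω] : IsMAccretive X.B :=
  X.isContractionSemigroup_adjSemigroup.isMAccretive_generator

end FiniteMeasure

end Environment

/-! ### Null vectors and spectral gaps -/

section NullVector

variable {E : Type*} [NormedAddCommGroup E] [InnerProductSpace ℂ E] {e : E}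

theorem inner_sub_inner_smul (he : ‖e‖ = 1) (x : E) : ⟪e, x - ⟪e, x⟫_ℂ • e⟫_ℂ = 0 := by
  rw [inner_sub_right, inner_smul_self_eq, he, one_pow, Complex.ofReal_one, mul_one, sub_self]

theorem norm_sq_eq_norm_sub_inner_smul_sq_add (he : ‖e‖ = 1) (x : E) :
    ‖x‖ ^ 2 = ‖x - ⟪e, x⟫_ℂ • e‖ ^ 2 + ‖⟪e, x⟫_ℂ‖ ^ 2 := by
  have horth : ⟪x - ⟪e, x⟫_ℂ • e, ⟪e, x⟫_ℂ • e⟫_ℂ = 0 := by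
    rw [inner_smul_right, inner_eq_zero_symm.1 (inner_sub_inner_smul he x), mul_zero]
  have hpyth := norm_add_sq_eq_norm_sq_add_norm_sq_of_inner_eq_zero _ _ horth
  rwa [sub_add_cancel, norm_smul, he, mul_one, ← sq, ← sq, ← sq] at hpyth

theorem norm_sub_inner_smul_le (he : ‖e‖ = 1) (x : E) : ‖x - ⟪e, x⟫_ℂ • e‖ ≤ ‖x‖ := by
  refine le_of_sq_le_sq ?_ (norm_nonneg x)
  rw [norm_sq_eq_norm_sub_inner_smul_sq_add he x]
  exact le_add_of_nonneg_right (sq_nonneg _)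

/-- `e` is a unit vector in the kernel of `A` and orthogonal to the range of `A`. -/
structure IsNullVector (A : E →ₗ.[ℂ] E) (e : E) : Prop where
  norm_eq_one : ‖e‖ = 1
  mem_graph : (e, 0) ∈ A.graph
  inner_eq_zero : ∀ ⦃x z⦄, (x, z) ∈ A.graph → ⟪e, z⟫_ℂ = 0

/-- The extension of `R` from the orthogonal complement of `e` by `-w⁻¹` on the multiples of `e`.
It is the resolvent at `w` of an operator with null vector `e` if `R` is the resolvent of its
restriction to the orthogonal complement. -/
def extendResolvent (w : ℂ) (R : (ℂ ∙ e)ᗮ →L[ℂ] (ℂ ∙ e)ᗮ) : E →L[ℂ] E :=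
  (ℂ ∙ e)ᗮ.subtypeL.comp (R.comp (ℂ ∙ e)ᗮ.orthogonalProjectionOnto) -
    w⁻¹ • (innerSL ℂ e).smulRight e

theorem extendResolvent_apply (w : ℂ) (R : (ℂ ∙ e)ᗮ →L[ℂ] (ℂ ∙ e)ᗮ) (y : E) :
    extendResolvent w R y =
      (R ((ℂ ∙ e)ᗮ.orthogonalProjectionOnto y) : E) - (w⁻¹ * ⟪e, y⟫_ℂ) • e := by
  rw [mul_smul]
  rfl

theorem coe_orthogonalProjectionOnto_orthogonal_singleton (he : ‖e‖ = 1) (x : E) :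
    ((ℂ ∙ e)ᗮ.orthogonalProjectionOnto x : E) = x - ⟪e, x⟫_ℂ • e := by
  rw [← Submodule.starProjection_apply, Submodule.starProjection_orthogonal_val,
    Submodule.starProjection_unit_singleton ℂ he]

theorem norm_extendResolvent_le (he : ‖e‖ = 1) (w : ℂ) (R : (ℂ ∙ e)ᗮ →L[ℂ] (ℂ ∙ e)ᗮ) :
    ‖extendResolvent w R‖ ≤ ‖R‖ + 1 / ‖w‖ := by
  refine (extendResolvent w R).opNorm_le_bound (by positivity) fun y => ?_
  rw [extendResolvent_apply, add_mul]
  refine (norm_sub_le _ _).trans (add_le_add ?_ ?_)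
  · refine (R.le_opNorm _).trans ?_
    gcongr
    exact Submodule.norm_orthogonalProjectionOnto_apply_le _ y
  · rw [norm_smul, he, mul_one, norm_mul, norm_inv, one_div]
    gcongr
    exact (norm_inner_le_norm e y).trans_eq (by rw [he, one_mul])

namespace IsNullVector

variable {A : E →ₗ.[ℂ] E}

theorem exists_apply_eq_zero (he : IsNullVector A e) : ∃ h : e ∈ A.domain, A ⟨e, h⟩ = 0 :=
  have h := LinearPMap.mem_domain_of_mem_graph he.mem_graph
  ⟨h, A.mem_graph_snd_inj (A.mem_graph ⟨e, h⟩) he.mem_graph rfl⟩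

theorem apply_mem_orthogonal (he : IsNullVector A e) (x : A.domain) : A x ∈ (ℂ ∙ e)ᗮ :=
  Submodule.mem_orthogonal_singleton_iff_inner_right.2 (he.inner_eq_zero (A.mem_graph x))

theorem exists_adjoint_apply_eq_zero [CompleteSpace E] (he : IsNullVector A e)
    (hA : Dense (A.domain : Set E)) : ∃ h : e ∈ A.adjoint.domain, A.adjoint ⟨e, h⟩ = 0 := by
  have hinner (x : A.domain) : ⟪(0 : E), x⟫_ℂ = ⟪e, A x⟫_ℂ := by
    rw [inner_zero_left, he.inner_eq_zero (A.mem_graph x)]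
  exact ⟨LinearPMap.mem_adjoint_domain_of_exists _ ⟨0, hinner⟩,
    LinearPMap.adjoint_apply_eq hA _ hinner⟩

theorem sub_smul_mem_graph (he : IsNullVector A e) {x z : E} (h : (x, z) ∈ A.graph) (c : ℂ) :
    (x - c • e, z) ∈ A.graph := by
  simpa using A.graph.sub_mem h (A.graph.smul_mem c he.mem_graph)

theorem isMAccretive_restrictTo (he : IsNullVector A e) (hA : IsMAccretive A) :
    IsMAccretive (restrictTo A (ℂ ∙ e)ᗮ) where
  re_inner_nonneg x z hxz := hA.re_inner_nonneg ((mem_restrictTo_graph A _ x z).1 hxz)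
  exists_isResolvent_neg := by
    obtain ⟨a, ha, R, hR⟩ := hA.exists_isResolvent_neg
    refine ⟨a, ha, _, hR.restrictTo fun y hy => ?_⟩
    rw [Submodule.mem_orthogonal_singleton_iff_inner_right] at hy ⊢
    have h := he.inner_eq_zero ((isResolvent_iff_graph.1 hR).1 y)
    rw [inner_add_right, hy, zero_add, inner_smul_right] at h
    exact (mul_eq_zero.1 h).resolve_left (neg_ne_zero.2 (Complex.ofReal_ne_zero.2 ha.ne'))

theorem isResolvent_extendResolvent (he : IsNullVector A e) {w : ℂ} (hw : w ≠ 0)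
    {R : (ℂ ∙ e)ᗮ →L[ℂ] (ℂ ∙ e)ᗮ} (hR : IsResolvent (restrictTo A (ℂ ∙ e)ᗮ) w R) :
    IsResolvent A w (extendResolvent w R) := by
  have hproj := coe_orthogonalProjectionOnto_orthogonal_singleton he.norm_eq_one
  simp only [isResolvent_iff_graph, mem_restrictTo_graph] at hR
  refine isResolvent_iff_graph.2 ⟨fun y => ?_, fun x z hxz => ?_⟩
  · convert he.sub_smul_mem_graph (hR.1 ((ℂ ∙ e)ᗮ.orthogonalProjectionOnto y))
      (w⁻¹ * ⟪e, y⟫_ℂ) using 2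
    · exact extendResolvent_apply w R y
    · rw [extendResolvent_apply, Submodule.coe_add, hproj, Submodule.coe_smul, smul_sub, smul_smul,
        mul_inv_cancel_left₀ hw]
      abel
  · have hz := he.inner_eq_zero hxz
    have hRx : R ((ℂ ∙ e)ᗮ.orthogonalProjectionOnto (z - w • x)) =
        (ℂ ∙ e)ᗮ.orthogonalProjectionOnto x := by
      rw [map_sub, map_smul]
      refine hR.2 ?_
      rw [hproj, hproj, hz, zero_smul, sub_zero]
      exact he.sub_smul_mem_graph hxz _
    rw [extendResolvent_apply, hRx, hproj, inner_sub_right, hz, inner_smul_right, zero_sub, mul_neg,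
      inv_mul_cancel_left₀ hw, neg_smul, sub_neg_eq_add, sub_add_cancel]

end IsNullVector

/-- A maximal accretive operator with null vector `e`, and with spectral gap `1 / T` and sectorial
numerical range on the orthogonal complement of `e`. -/
structure IsGapped (B : E →ₗ.[ℂ] E) (e : E) (T q b : ℝ) : Prop
    extends IsNullVector B e, IsMAccretive B where
  gap : ∀ ⦃x z⦄, (x, z) ∈ B.graph → ⟪e, x⟫_ℂ = 0 → 1 / T * ‖x‖ ^ 2 ≤ (⟪x, z⟫_ℂ).re
  sectorial : ∀ ⦃x z⦄, (x, z) ∈ B.graph → ⟪e, x⟫_ℂ = 0 → ‖x‖ = 1 →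
    |(⟪x, z⟫_ℂ).im| ≤ q * |(⟪x, z⟫_ℂ).re + b|

namespace IsGapped

variable {B : E →ₗ.[ℂ] E} {T q b : ℝ} {x z : E}

theorem inner_sub_inner_smul_left (hB : IsGapped B e T q b) (h : (x, z) ∈ B.graph) :
    ⟪x - ⟪e, x⟫_ℂ • e, z⟫_ℂ = ⟪x, z⟫_ℂ := by
  rw [inner_sub_left, inner_smul_left, hB.inner_eq_zero h, mul_zero, sub_zero]

theorem one_div_mul_norm_sq_le_re_inner (hB : IsGapped B e T q b) (h : (x, z) ∈ B.graph) :
    1 / T * ‖x - ⟪e, x⟫_ℂ • e‖ ^ 2 ≤ (⟪x, z⟫_ℂ).re := by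
  rw [← hB.inner_sub_inner_smul_left h]
  exact hB.gap (hB.sub_smul_mem_graph h _) (inner_sub_inner_smul hB.norm_eq_one x)

theorem norm_le_mul_norm (hB : IsGapped B e T q b) (hT : 0 < T) (h : (x, z) ∈ B.graph)
    (hx : ⟪e, x⟫_ℂ = 0) : ‖x‖ ≤ T * ‖z‖ := by
  have hle := sub_re_mul_norm_le_norm_sub_smul 0 (hB.gap h hx)
  rwa [Complex.zero_re, sub_zero, zero_smul, sub_zero, one_div_mul_eq_div, div_le_iff₀' hT] at hle

theorem exists_mem_graph [CompleteSpace E] (hB : IsGapped B e T q b) (hT : 0 < T) {g : E}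
    (hg : ⟪e, g⟫_ℂ = 0) : ∃ u, (u, g) ∈ B.graph ∧ ⟪e, u⟫_ℂ = 0 := by
  have hmem {x : E} : x ∈ (ℂ ∙ e)ᗮ ↔ ⟪e, x⟫_ℂ = 0 :=
    Submodule.mem_orthogonal_singleton_iff_inner_right
  have hbelow : ∀ w ∈ {w : ℂ | w.re ≤ 0},
      IsBoundedBelowAt (restrictTo B (ℂ ∙ e)ᗮ) w (1 / T) := by
    intro w hw x z hxz
    have hle := sub_re_mul_norm_le_norm_sub_smul w
      (hB.gap ((mem_restrictTo_graph B _ x z).1 hxz) (hmem.1 x.2))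
    exact (mul_le_mul_of_nonneg_right (le_sub_self_iff _ |>.2 hw) (norm_nonneg _)).trans hle
  obtain ⟨R, hR⟩ := exists_isResolvent_of_isPreconnected
    (convex_halfSpace_re_le 0).isPreconnected (one_div_pos.2 hT) hbelow
    (w₀ := -1) (w₁ := 0) (by simp) (by simp)
    ((hB.isMAccretive_restrictTo hB.toIsMAccretive).exists_isResolvent (by simp))
  have hgraph := (isResolvent_iff_graph.1 hR).1 ⟨g, hmem.2 hg⟩
  rw [zero_smul, add_zero, mem_restrictTo_graph] at hgraph
  exact ⟨_, hgraph, hmem.1 (R ⟨g, hmem.2 hg⟩).2⟩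

theorem abs_im_inner_le (hB : IsGapped B e T q b) (h : (x, z) ∈ B.graph) (hx : ⟪e, x⟫_ℂ = 0) :
    |(⟪x, z⟫_ℂ).im| ≤ q * |(⟪x, z⟫_ℂ).re + b * ‖x‖ ^ 2| := by
  rcases eq_or_ne x 0 with rfl | hx0
  · simp
  have hn : 0 < ‖x‖ ^ 2 := by positivity
  have hnorm : ‖((‖x‖⁻¹ : ℝ) : ℂ) • x‖ = 1 := by
    simpa using norm_smul_inv_norm (𝕜 := ℂ) hx0
  have hinner : ⟪((‖x‖⁻¹ : ℝ) : ℂ) • x, ((‖x‖⁻¹ : ℝ) : ℂ) • z⟫_ℂ =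
      (((‖x‖ ^ 2)⁻¹ : ℝ) : ℂ) * ⟪x, z⟫_ℂ := by
    rw [inner_smul_left, inner_smul_right, Complex.conj_ofReal, ← mul_assoc, ← Complex.ofReal_mul,
      ← sq, inv_pow]
  have hsec := hB.sectorial (B.graph.smul_mem ((‖x‖⁻¹ : ℝ) : ℂ) h)
    (by rw [inner_smul_right, hx, mul_zero]) hnorm
  rw [hinner, Complex.im_ofReal_mul, Complex.re_ofReal_mul] at hsec
  calc |(⟪x, z⟫_ℂ).im| = ‖x‖ ^ 2 * |(‖x‖ ^ 2)⁻¹ * (⟪x, z⟫_ℂ).im| := by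
        rw [abs_mul, abs_of_pos (inv_pos.2 hn), mul_inv_cancel_left₀ hn.ne']
    _ ≤ ‖x‖ ^ 2 * (q * |(‖x‖ ^ 2)⁻¹ * (⟪x, z⟫_ℂ).re + b|) := by gcongr
    _ = q * |(⟪x, z⟫_ℂ).re + b * ‖x‖ ^ 2| := by
        rw [mul_left_comm, ← abs_of_pos hn, ← abs_mul, abs_of_pos hn, mul_add,
          mul_inv_cancel_left₀ hn.ne', mul_comm b]

theorem hasSectorialForm (hB : IsGapped B e T q b) : HasSectorialForm B (|q| + 1) |b| := by
  intro x z h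
  set y := x - ⟪e, x⟫_ℂ • e
  have hre := hB.re_inner_nonneg h
  have him := hB.abs_im_inner_le (hB.sub_smul_mem_graph h _) (inner_sub_inner_smul hB.norm_eq_one x)
  rw [hB.inner_sub_inner_smul_left h] at him
  have hy : ‖y‖ ^ 2 ≤ ‖x‖ ^ 2 := by
    gcongr
    exact norm_sub_inner_smul_le hB.norm_eq_one x
  calc |(⟪x, z⟫_ℂ).im| ≤ q * |(⟪x, z⟫_ℂ).re + b * ‖y‖ ^ 2| := him
    _ ≤ (|q| + 1) * |(⟪x, z⟫_ℂ).re + b * ‖y‖ ^ 2| := by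
        gcongr
        exact (le_abs_self q).trans (le_add_of_nonneg_right zero_le_one)
    _ ≤ (|q| + 1) * ((⟪x, z⟫_ℂ).re + |b| * ‖x‖ ^ 2) := by
        gcongr
        calc |(⟪x, z⟫_ℂ).re + b * ‖y‖ ^ 2| ≤ |(⟪x, z⟫_ℂ).re| + |b * ‖y‖ ^ 2| := abs_add_le _ _
          _ ≤ (⟪x, z⟫_ℂ).re + |b| * ‖x‖ ^ 2 := by
            rw [abs_of_nonneg hre, abs_mul, abs_of_nonneg (sq_nonneg ‖y‖)]
            gcongr

end IsGapped

end NullVector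

/-! ### The coupled operator -/

section Coupling

variable {ι E : Type*} [NormedAddCommGroup E]

theorem mul_norm_le_add_of_forall_norm_le {F : Type*} [NormedAddCommGroup F]
    {x : lp (fun _ : ι => E) 2} {y z : lp (fun _ : ι => F) 2} {r s t : ℝ} (hr : 0 ≤ r) (hs : 0 ≤ s)
    (ht : 0 ≤ t) (h : ∀ i, r * ‖x i‖ ≤ s * ‖y i‖ + t * ‖z i‖) : r * ‖x‖ ≤ s * ‖y‖ + t * ‖z‖ := by
  have hconj : (2 : ℝ≥0∞).toReal.HolderConjugate (2 : ℝ≥0∞).toReal := by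
    rw [ENNReal.toReal_ofNat]
    exact Real.HolderConjugate.two_two
  have hcauchy := lp.tsum_mul_le_mul_norm' hconj y z
  have hsum := (((hasSum_norm_sq y).mul_left (s ^ 2)).add
    ((lp.summable_mul hconj y z).hasSum.mul_left (2 * s * t))).add
    ((hasSum_norm_sq z).mul_left (t ^ 2))
  refine le_of_sq_le_sq ?_ (by positivity)
  calc (r * ‖x‖) ^ 2 = r ^ 2 * ‖x‖ ^ 2 := mul_pow _ _ _
    _ ≤ s ^ 2 * ‖y‖ ^ 2 + 2 * s * t * ∑' i, ‖y i‖ * ‖z i‖ + t ^ 2 * ‖z‖ ^ 2 := by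
      refine hasSum_le (fun i => ?_) ((hasSum_norm_sq x).mul_left (r ^ 2)) hsum
      calc r ^ 2 * ‖x i‖ ^ 2 = (r * ‖x i‖) ^ 2 := (mul_pow _ _ _).symm
        _ ≤ (s * ‖y i‖ + t * ‖z i‖) ^ 2 := by gcongr; exact h i
        _ = s ^ 2 * ‖y i‖ ^ 2 + 2 * s * t * (‖y i‖ * ‖z i‖) + t ^ 2 * ‖z i‖ ^ 2 := by ring
    _ ≤ s ^ 2 * ‖y‖ ^ 2 + 2 * s * t * (‖y‖ * ‖z‖) + t ^ 2 * ‖z‖ ^ 2 := by gcongr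
    _ = (s * ‖y‖ + t * ‖z‖) ^ 2 := by ring

variable [InnerProductSpace ℂ E] {A : lp (fun _ : ι => E) 2 →L[ℂ] lp (fun _ : ι => E) 2}
  {B : E →ₗ.[ℂ] E} {e : E} {o : ι} {g : ι → E} {χ T q b : ℝ} {w : ℂ} {x z : lp (fun _ : ι => E) 2}

/-- The component of `x` in `ℓ²(ι) ⊗ e`, for a unit vector `e`. -/
def alongPart (e : E) : lp (fun _ : ι => E) 2 →L[ℂ] lp (fun _ : ι => E) 2 :=
  blockOp (Equiv.refl ι) (fun _ => (innerSL ℂ e).smulRight e) _ fun _ => le_rfl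

theorem alongPart_apply (e : E) (x : lp (fun _ : ι => E) 2) (i : ι) :
    alongPart e x i = ⟪e, x i⟫_ℂ • e := rfl

theorem sub_alongPart_apply (e : E) (x : lp (fun _ : ι => E) 2) (i : ι) :
    (x - alongPart e x) i = x i - ⟪e, x i⟫_ℂ • e := rfl

theorem alongPart_alongPart (he : ‖e‖ = 1) (x : lp (fun _ : ι => E) 2) :
    alongPart e (alongPart e x) = alongPart e x := by
  ext i : 2
  rw [alongPart_apply, alongPart_apply, inner_smul_self_eq, he, one_pow, Complex.ofReal_one,
    mul_one]

theorem norm_sub_alongPart_le (he : ‖e‖ = 1) (x : lp (fun _ : ι => E) 2) :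
    ‖x - alongPart e x‖ ≤ ‖x‖ :=
  lp.norm_mono two_ne_zero fun i => norm_sub_inner_smul_le he (x i)

theorem alongPart_single [DecidableEq ι] (he : ‖e‖ = 1) (o : ι) :
    alongPart e (lp.single 2 o e : lp (fun _ : ι => E) 2) = lp.single 2 o e := by
  ext i : 2
  rw [alongPart_apply]
  rcases eq_or_ne i o with rfl | hi
  · rw [lp.single_apply_self, inner_self_eq_norm_sq_to_K, he, RCLike.ofReal_one, one_pow, one_smul]
  · rw [lp.single_apply_ne _ _ _ hi, inner_zero_right, zero_smul]

theorem mem_orthogonal_single_iff [DecidableEq ι] :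
    x ∈ (ℂ ∙ (lp.single 2 o e : lp (fun _ : ι => E) 2))ᗮ ↔ ⟪e, x o⟫_ℂ = 0 := by
  rw [Submodule.mem_orthogonal_singleton_iff_inner_right, lp.inner_single_left]

/-- The operator `i A + 1 ⊗ B`. It is `L̂₀` for `A = K̂ + V̂`. -/
def coupledOp (A : lp (fun _ : ι => E) 2 →L[ℂ] lp (fun _ : ι => E) 2) (B : E →ₗ.[ℂ] E) :
    lp (fun _ : ι => E) 2 →ₗ.[ℂ] lp (fun _ : ι => E) 2 :=
  (Complex.I • A).toLinearMap +ᵥ ampliation ι B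

theorem mem_coupledOp_graph :
    (x, z) ∈ (coupledOp A B).graph ↔ ∀ i, (x i, (z - Complex.I • A x) i) ∈ B.graph := by
  rw [coupledOp, mem_vadd_graph, mem_ampliation_graph]
  rfl

/-- A bounded symmetric operator on `ℓ²(ι; E)` that maps `c_i ⊗ e` to `c_i g_i`, where the `g_i`
are orthogonal to `e`, `g_o = 0` and `B⁻¹ g_i` has norm at least `χ` for `i ≠ o`. For `K̂ + V̂` the
unit vector `e` is the constant function `1` and `g_x = v_x - v_0`. -/
structure IsCoupling (A : lp (fun _ : ι => E) 2 →L[ℂ] lp (fun _ : ι => E) 2) (B : E →ₗ.[ℂ] E)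
    (e : E) (o : ι) (g : ι → E) (χ : ℝ) : Prop where
  symm : ∀ x y, ⟪x, A y⟫_ℂ = ⟪A x, y⟫_ℂ
  apply_alongPart : ∀ x i, A (alongPart e x) i = ⟪e, x i⟫_ℂ • g i
  apply_origin : g o = 0
  inner_eq_zero : ∀ i, ⟪e, g i⟫_ℂ = 0
  nondegenerate : ∀ i, i ≠ o → ∀ u, (u, g i) ∈ B.graph → ⟪e, u⟫_ℂ = 0 → χ ≤ ‖u‖

namespace IsCoupling

theorem apply_single [DecidableEq ι] (hA : IsCoupling A B e o g χ) (he : ‖e‖ = 1) :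
    A (lp.single 2 o e) = 0 := by
  ext i : 2
  rw [← alongPart_single he, hA.apply_alongPart, lp.coeFn_zero, Pi.zero_apply]
  rcases eq_or_ne i o with rfl | hi
  · rw [hA.apply_origin, smul_zero]
  · rw [lp.single_apply_ne _ _ _ hi, inner_zero_right, zero_smul]

theorem isNullVector [DecidableEq ι] (hA : IsCoupling A B e o g χ) (hB : IsNullVector B e) :
    IsNullVector (coupledOp A B) (lp.single 2 o e) where
  norm_eq_one := by rw [lp.norm_single two_pos, hB.norm_eq_one]
  mem_graph := by
    rw [mem_coupledOp_graph, hA.apply_single hB.norm_eq_one, smul_zero, sub_zero]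
    intro i
    rcases eq_or_ne i o with rfl | hi
    · rw [lp.single_apply_self]
      exact hB.mem_graph
    · rw [lp.single_apply_ne _ _ _ hi]
      exact B.graph.zero_mem
  inner_eq_zero x z hxz := by
    have hBz := hB.inner_eq_zero (mem_coupledOp_graph.1 hxz o)
    have hinner := lp.inner_single_left (𝕜 := ℂ) o e (z - Complex.I • A x)
    rwa [hBz, inner_sub_right, inner_smul_right, hA.symm, hA.apply_single hB.norm_eq_one,
      inner_zero_left, mul_zero, sub_zero] at hinner

theorem re_inner_I_smul (hA : IsCoupling A B e o g χ) (x : lp (fun _ : ι => E) 2) :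
    (⟪x, (Complex.I • A) x⟫_ℂ).re = 0 := by
  rw [smul_apply, inner_smul_right, Complex.I_mul_re, neg_eq_zero, ← Complex.conj_eq_iff_im,
    inner_conj_symm, hA.symm]

theorem isMAccretive [CompleteSpace E] (hA : IsCoupling A B e o g χ) (hB : IsMAccretive B) :
    IsMAccretive (coupledOp A B) :=
  (hB.ampliation ι).vadd fun x => (hA.re_inner_I_smul x).ge

theorem re_inner_ge (hA : IsCoupling A B e o g χ) (hB : IsGapped B e T q b)
    (hxz : (x, z) ∈ (coupledOp A B).graph) :
    1 / T * ‖x - alongPart e x‖ ^ 2 ≤ (⟪x, z⟫_ℂ).re := by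
  have hinner : (⟪x, z⟫_ℂ).re = (⟪x, z - Complex.I • A x⟫_ℂ).re := by
    rw [inner_sub_right, Complex.sub_re, ← smul_apply, hA.re_inner_I_smul, sub_zero]
  rw [hinner]
  have hsite (i : ι) : 1 / T * ‖(x - alongPart e x) i‖ ^ 2 ≤
      (⟪x i, (z - Complex.I • A x) i⟫_ℂ).re :=
    hB.one_div_mul_norm_sq_le_re_inner (mem_coupledOp_graph.1 hxz i)
  have hsum := Complex.hasSum_re (lp.hasSum_inner (𝕜 := ℂ) x (z - Complex.I • A x))
  exact hasSum_le hsite ((hasSum_norm_sq (x - alongPart e x)).mul_left (1 / T)) hsum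

theorem apply_eq_add_smul (hA : IsCoupling A B e o g χ) (x : lp (fun _ : ι => E) 2) (i : ι) :
    A x i = A (x - alongPart e x) i + ⟪e, x i⟫_ℂ • g i := by
  rw [← hA.apply_alongPart x i, ← Pi.add_apply, ← lp.coeFn_add, ← map_add, sub_add_cancel]

/-- Since `A` maps `c_i ⊗ e` to `c_i g_i`, adding `i c_i B⁻¹ g_i` to the component of `x i`
orthogonal to `e` removes from `B` the contribution of the component along `e`. -/
theorem mem_graph_of_mem_graph (hA : IsCoupling A B e o g χ) (hB : IsNullVector B e)
    (hxz : (x, z) ∈ (coupledOp A B).graph) {i : ι} {u : E} (hu : (u, g i) ∈ B.graph) :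
    ((x - alongPart e x) i + (Complex.I * ⟪e, x i⟫_ℂ) • u,
      (z - Complex.I • A (x - alongPart e x)) i) ∈ B.graph := by
  have hz : (z - Complex.I • A (x - alongPart e x)) i =
      (z - Complex.I • A x) i + (Complex.I * ⟪e, x i⟫_ℂ) • g i := by
    change z i - Complex.I • A (x - alongPart e x) i = z i - Complex.I • A x i + _
    rw [hA.apply_eq_add_smul x i]
    module
  rw [hz]
  exact B.graph.add_mem (hB.sub_smul_mem_graph (mem_coupledOp_graph.1 hxz i) ⟪e, x i⟫_ℂ)
    (B.graph.smul_mem (Complex.I * ⟪e, x i⟫_ℂ) hu)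

theorem mul_norm_alongPart_le [CompleteSpace E] (hA : IsCoupling A B e o g χ)
    (hB : IsGapped B e T q b) (hT : 0 < T) (hχ : 0 ≤ χ) (hxz : (x, z) ∈ (coupledOp A B).graph)
    (hx : ⟪e, x o⟫_ℂ = 0) :
    χ * ‖alongPart e x‖ ≤ T * ‖z - Complex.I • A (x - alongPart e x)‖ + ‖x - alongPart e x‖ := by
  have hsite (i : ι) : χ * ‖alongPart e x i‖ ≤
      T * ‖(z - Complex.I • A (x - alongPart e x)) i‖ + 1 * ‖(x - alongPart e x) i‖ := by
    rw [alongPart_apply, norm_smul, hB.norm_eq_one, mul_one, one_mul]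
    rcases eq_or_ne i o with rfl | hi
    · rw [hx, norm_zero, mul_zero]
      positivity
    obtain ⟨u, hu, hue⟩ := hB.exists_mem_graph hT (hA.inner_eq_zero i)
    have horth : ⟪e, (x - alongPart e x) i + (Complex.I * ⟪e, x i⟫_ℂ) • u⟫_ℂ = 0 := by
      rw [inner_add_right, inner_smul_right, hue, mul_zero, add_zero, sub_alongPart_apply,
        inner_sub_inner_smul hB.norm_eq_one]
    have hnorm : ‖(Complex.I * ⟪e, x i⟫_ℂ) • u‖ = ‖⟪e, x i⟫_ℂ‖ * ‖u‖ := by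
      rw [norm_smul, norm_mul, Complex.norm_I, one_mul]
    calc χ * ‖⟪e, x i⟫_ℂ‖ ≤ ‖u‖ * ‖⟪e, x i⟫_ℂ‖ := by
          gcongr
          exact hA.nondegenerate i hi u hu hue
      _ = ‖((x - alongPart e x) i + (Complex.I * ⟪e, x i⟫_ℂ) • u) - (x - alongPart e x) i‖ := by
          rw [add_sub_cancel_left, hnorm, mul_comm]
      _ ≤ ‖(x - alongPart e x) i + (Complex.I * ⟪e, x i⟫_ℂ) • u‖ + ‖(x - alongPart e x) i‖ :=
          norm_sub_le _ _
      _ ≤ _ := by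
          gcongr
          exact hB.norm_le_mul_norm hT (hA.mem_graph_of_mem_graph hB.toIsNullVector hxz hu) horth
  rw [← one_mul ‖x - alongPart e x‖]
  exact mul_norm_le_add_of_forall_norm_le hχ hT.le zero_le_one hsite

theorem alongPart_sub_I_smul [CompleteSpace E] (hA : IsCoupling A B e o g χ)
    (hB : IsGapped B e T q b) (hT : 0 < T) (hxz : (x, z) ∈ (coupledOp A B).graph) :
    alongPart e (z - Complex.I • A (x - alongPart e x)) = 0 := by
  ext i : 2
  obtain ⟨u, hu, -⟩ := hB.exists_mem_graph hT (hA.inner_eq_zero i)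
  rw [alongPart_apply,
    hB.inner_eq_zero (hA.mem_graph_of_mem_graph hB.toIsNullVector hxz hu), zero_smul]
  rfl

theorem norm_sub_I_smul_le [CompleteSpace E] (hA : IsCoupling A B e o g χ)
    (hB : IsGapped B e T q b) (hT : 0 < T) (hxz : (x, z) ∈ (coupledOp A B).graph) (w : ℂ) :
    ‖z - Complex.I • A (x - alongPart e x)‖ ≤
      ‖z - w • x‖ + (‖w‖ + ‖A‖) * ‖x - alongPart e x‖ := by
  set η := x - alongPart e x with hη
  set y := z - Complex.I • A η - w • alongPart e x with hy
  have hproj : y - alongPart e y = z - Complex.I • A η := by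
    have halong := hA.alongPart_sub_I_smul hB hT hxz
    rw [hy, (alongPart e).map_sub, (alongPart e).map_smul, halong,
      alongPart_alongPart hB.norm_eq_one, zero_sub, sub_neg_eq_add, sub_add_cancel]
  calc ‖z - Complex.I • A η‖ ≤ ‖y‖ := by
        rw [← hproj]
        exact norm_sub_alongPart_le hB.norm_eq_one y
    _ = ‖z - w • x + w • η - Complex.I • A η‖ := by
        rw [hy, hη]
        congr 1
        module
    _ ≤ ‖z - w • x‖ + ‖w • η‖ + ‖Complex.I • A η‖ :=
        (norm_sub_le _ _).trans (add_le_add_left (norm_add_le _ _) _)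
    _ ≤ ‖z - w • x‖ + ‖w‖ * ‖η‖ + ‖A‖ * ‖η‖ := by
        rw [norm_smul, norm_smul, Complex.norm_I, one_mul]
        gcongr
        exact A.le_opNorm η
    _ = ‖z - w • x‖ + (‖w‖ + ‖A‖) * ‖η‖ := by ring

end IsCoupling

end Coupling

/-! ### Resolvent bounds outside a truncated sector -/

theorem isClosed_truncatedSector (T γ p c : ℝ) : IsClosed (truncatedSector T γ p c) :=
  (isClosed_le continuous_const Complex.continuous_re).inter
    (isClosed_le Complex.continuous_im.abs (by fun_prop))

section Sector

variable {E : Type*} [NormedAddCommGroup E] [InnerProductSpace ℂ E] {A : E →ₗ.[ℂ] E}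

/-- A half-line going left from a point outside the sector stays outside the sector, and reaches
the half-plane `Re w < 0`. -/
theorem IsMAccretive.exists_isResolvent_of_notMem_truncatedSector [CompleteSpace E]
    (hA : IsMAccretive A) {T γ p c m : ℝ} (hp : 0 ≤ p) (hm : 0 < m)
    (hlow : ∀ w ∉ truncatedSector T γ p c, IsBoundedBelowAt A w m) {w : ℂ}
    (hw : w ∉ truncatedSector T γ p c) : ∃ R, IsResolvent A w R := by
  have hconvex : Convex ℝ ({w' : ℂ | w'.re ≤ w.re} ∩ {w' : ℂ | w'.im = w.im}) :=
    (convex_halfSpace_re_le _).inter (convex_hyperplane Complex.imLm.isLinear w.im)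
  refine exists_isResolvent_of_isPreconnected hconvex.isPreconnected hm
    (fun w' hw' => hlow w' fun hmem => hw ?_) (w₀ := ⟨min w.re (-1), w.im⟩)
    ⟨min_le_left w.re (-1), rfl⟩ ⟨le_refl w.re, rfl⟩
    (hA.exists_isResolvent (min_lt_of_right_lt neg_one_lt_zero))
  obtain ⟨hre : w'.re ≤ w.re, him : w'.im = w.im⟩ := hw'
  refine ⟨hmem.1.trans hre, ?_⟩
  rw [← him]
  exact hmem.2.trans (by gcongr)

theorem IsNullVector.exists_isResolvent_norm_le {e : E} (he : IsNullVector A e) {S : Set ℂ}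
    (hS : IsClosed S) {m : ℝ} (hm : 0 < m) {w : ℂ} (hw : w ∉ {0} ∪ S)
    (hlow : IsBoundedBelowAt (restrictTo A (ℂ ∙ e)ᗮ) w (m * ‖w‖))
    (hR : ∃ R, IsResolvent (restrictTo A (ℂ ∙ e)ᗮ) w R) :
    ∃ R, IsResolvent A w R ∧ ‖R‖ ≤ (1 / m + 1) / Metric.infDist w ({0} ∪ S) := by
  obtain ⟨R, hR⟩ := hR
  have hw₀ : w ≠ 0 := fun h => hw (Or.inl h)
  have hzero : (0 : ℂ) ∈ {0} ∪ S := Or.inl rfl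
  have hdist : Metric.infDist w ({0} ∪ S) ≤ ‖w‖ := by
    simpa using Metric.infDist_le_dist_of_mem (x := w) hzero
  have hpos : 0 < Metric.infDist w ({0} ∪ S) :=
    ((isClosed_singleton.union hS).notMem_iff_infDist_pos ⟨0, hzero⟩).1 hw
  refine ⟨extendResolvent w R, he.isResolvent_extendResolvent hw₀ hR, ?_⟩
  calc ‖extendResolvent w R‖ ≤ ‖R‖ + 1 / ‖w‖ := norm_extendResolvent_le he.norm_eq_one w R
    _ ≤ 1 / (m * ‖w‖) + 1 / ‖w‖ := by gcongr; exact hR.norm_le (by positivity) hlow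
    _ = (1 / m + 1) / ‖w‖ := by field_simp
    _ ≤ (1 / m + 1) / Metric.infDist w ({0} ∪ S) := by gcongr

end Sector

theorem le_mul_of_le_add_of_sq_le {x y f M N T γ : ℝ} (hx : 0 ≤ x) (hf : 0 ≤ f) (hN : 0 ≤ N)
    (hT : 0 ≤ T) (hxy : x ≤ M * y + N * f) (hy : y ^ 2 ≤ T * (x * f) + γ * x ^ 2)
    (hγ : 8 * M ^ 2 * γ ≤ 1) : x ≤ (8 * M ^ 2 * T + 2 * N) * f := by
  rcases le_or_gt x (2 * (N * f)) with hsmall | hlarge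
  · nlinarith [mul_nonneg (mul_nonneg (sq_nonneg M) hT) hf]
  · have hMy : (x / 2) ^ 2 ≤ (M * y) ^ 2 := by gcongr; linarith
    have hxpos : 0 < x := lt_of_le_of_lt (by positivity) hlarge
    have hsq : x * x ≤ x * (8 * M ^ 2 * T * f) := by
      nlinarith [mul_le_mul_of_nonneg_left hy (sq_nonneg M),
        mul_le_mul_of_nonneg_right hγ (sq_nonneg x)]
    nlinarith [le_of_mul_le_mul_left hsq hxpos, mul_nonneg hN hf]

section Coupling

variable {ι E : Type*} [NormedAddCommGroup E] [InnerProductSpace ℂ E]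
  {A : lp (fun _ : ι => E) 2 →L[ℂ] lp (fun _ : ι => E) 2} {B : E →ₗ.[ℂ] E} {e : E} {o : ι}
  {g : ι → E} {χ T q b : ℝ} {w : ℂ} {x z : lp (fun _ : ι => E) 2}

theorem IsGapped.hasSectorialForm_coupledOp (hB : IsGapped B e T q b) :
    HasSectorialForm (coupledOp A B) (|q| + 1) (|b| + 2 * ‖A‖) := by
  have h := (hB.hasSectorialForm.ampliation ι).vadd
    (le_add_of_nonneg_left (abs_nonneg q)) (Complex.I • A)
  rwa [norm_smul, Complex.norm_I, one_mul] at h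

namespace IsCoupling

theorem norm_sub_alongPart_sq_le (hA : IsCoupling A B e o g χ) (hB : IsGapped B e T q b)
    (hT : 0 < T) (hxz : (x, z) ∈ (coupledOp A B).graph) {γ : ℝ} (hw : w.re ≤ γ / T) :
    ‖x - alongPart e x‖ ^ 2 ≤ T * (‖x‖ * ‖z - w • x‖) + γ * ‖x‖ ^ 2 := by
  have hre := (abs_le.1 (abs_re_inner_le_norm x (z - w • x))).2
  rw [inner_sub_right, Complex.sub_re, re_inner_smul_self] at hre
  have hgap : 1 / T * ‖x - alongPart e x‖ ^ 2 ≤ ‖x‖ * ‖z - w • x‖ + γ / T * ‖x‖ ^ 2 := by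
    linarith [hA.re_inner_ge hB hxz, mul_le_mul_of_nonneg_right hw (sq_nonneg ‖x‖)]
  calc ‖x - alongPart e x‖ ^ 2 = T * (1 / T * ‖x - alongPart e x‖ ^ 2) := by field_simp
    _ ≤ T * (‖x‖ * ‖z - w • x‖ + γ / T * ‖x‖ ^ 2) := by gcongr
    _ = T * (‖x‖ * ‖z - w • x‖) + γ * ‖x‖ ^ 2 := by field_simp

theorem norm_le_add [CompleteSpace E] (hA : IsCoupling A B e o g χ) (hB : IsGapped B e T q b)
    (hT : 0 < T) (hχ : 0 < χ) (hxz : (x, z) ∈ (coupledOp A B).graph) (hx : ⟪e, x o⟫_ℂ = 0)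
    {ρ : ℝ} (hw : ‖w‖ ≤ ρ) :
    ‖x‖ ≤ (1 + (1 + T * (ρ + ‖A‖)) / χ) * ‖x - alongPart e x‖ + T / χ * ‖z - w • x‖ := by
  set η := x - alongPart e x with hη
  have halong : χ * ‖alongPart e x‖ ≤ (1 + T * (ρ + ‖A‖)) * ‖η‖ + T * ‖z - w • x‖ :=
    calc χ * ‖alongPart e x‖ ≤ T * ‖z - Complex.I • A η‖ + ‖η‖ :=
          hA.mul_norm_alongPart_le hB hT hχ.le hxz hx
      _ ≤ T * (‖z - w • x‖ + (ρ + ‖A‖) * ‖η‖) + ‖η‖ := by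
          gcongr
          exact (hA.norm_sub_I_smul_le hB hT hxz w).trans (by gcongr)
      _ = (1 + T * (ρ + ‖A‖)) * ‖η‖ + T * ‖z - w • x‖ := by ring
  calc ‖x‖ = ‖η + alongPart e x‖ := by rw [hη, sub_add_cancel]
    _ ≤ ‖η‖ + ‖alongPart e x‖ := norm_add_le _ _
    _ ≤ ‖η‖ + ((1 + T * (ρ + ‖A‖)) * ‖η‖ + T * ‖z - w • x‖) / χ := by
        gcongr
        rwa [le_div_iff₀' hχ]
    _ = (1 + (1 + T * (ρ + ‖A‖)) / χ) * ‖η‖ + T / χ * ‖z - w • x‖ := by ring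

variable [DecidableEq ι] [CompleteSpace E]

theorem exists_isBoundedBelowAt_of_norm_le (hA : IsCoupling A B e o g χ)
    (hB : IsGapped B e T q b) (hT : 0 < T) (hχ : 0 < χ) {ρ : ℝ} (hρ : 0 ≤ ρ) :
    ∃ γ m : ℝ, 0 < γ ∧ γ < 1 ∧ 0 < m ∧ ∀ w : ℂ, w.re ≤ γ / T → ‖w‖ ≤ ρ →
      IsBoundedBelowAt (restrictTo (coupledOp A B) (ℂ ∙ lp.single 2 o e)ᗮ) w m := by
  set M : ℝ := 1 + (1 + T * (ρ + ‖A‖)) / χ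
  have hM : 1 ≤ M := le_add_of_nonneg_right (by positivity)
  have hγ : 1 / (8 * M ^ 2) < 1 := by
    rw [div_lt_one (by positivity)]
    nlinarith
  refine ⟨1 / (8 * M ^ 2), 1 / (8 * M ^ 2 * T + 2 * (T / χ)), by positivity, hγ, by positivity,
    fun w hre hw x z hxz => ?_⟩
  rw [mem_restrictTo_graph] at hxz
  rw [one_div_mul_eq_div, div_le_iff₀' (by positivity)]
  exact le_mul_of_le_add_of_sq_le (norm_nonneg _) (norm_nonneg _) (by positivity) hT.le
    (hA.norm_le_add hB hT hχ hxz (mem_orthogonal_single_iff.1 x.2) hw)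
    (hA.norm_sub_alongPart_sq_le hB hT hxz hre) (mul_one_div_cancel (by positivity)).le

theorem exists_isBoundedBelowAt_of_notMem_truncatedSector (hA : IsCoupling A B e o g χ)
    (hB : IsGapped B e T q b) (hT : 0 < T) (hχ : 0 < χ) :
    ∃ γ p c m : ℝ, 0 < γ ∧ γ < 1 ∧ 0 < p ∧ 0 < c ∧ 0 < m ∧ ∀ w ∉ truncatedSector T γ p c,
      IsBoundedBelowAt (restrictTo (coupledOp A B) (ℂ ∙ lp.single 2 o e)ᗮ) w
        (m * (1 + ‖w‖)) := by
  have hform := hB.hasSectorialForm_coupledOp (A := A)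
  set Q := |q| + 1
  set β := |b| + 2 * ‖A‖
  have hQ : 1 ≤ Q := le_add_of_nonneg_left (abs_nonneg q)
  have hβ : 0 ≤ β := by positivity
  set ρ := 2 * (2 * (1 + Q) * (1 / T) + Q * β) + 1
  have hρ : 0 ≤ ρ := by positivity
  obtain ⟨γ, m, hγ₀, hγ₁, hm, hlow⟩ := hA.exists_isBoundedBelowAt_of_norm_le hB hT hχ hρ
  refine ⟨γ, 2 * Q, β + 1, min (m / (1 + ρ)) (1 / (4 * (1 + Q))), hγ₀, hγ₁, by positivity,
    by positivity, by positivity, fun w hw => ?_⟩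
  have hlarge : min (m / (1 + ρ)) (1 / (4 * (1 + Q))) * (1 + ‖w‖) ≤
      1 / (4 * (1 + Q)) * (1 + ‖w‖) := by
    gcongr
    exact min_le_right _ _
  rcases le_or_gt (γ / T) w.re with hre | hre
  · have him : 2 * Q * (w.re + (β + 1)) < |w.im| := not_le.1 fun h => hw ⟨hre, h⟩
    exact ((hform.isBoundedBelowAt_of_mul_lt_abs_im hQ hβ (le_trans (by positivity) hre)
      him).restrictTo _).mono hlarge
  rcases le_or_gt ρ ‖w‖ with hnorm | hnorm
  · have hre' : w.re ≤ 1 / T := hre.le.trans (by gcongr)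
    exact (((hA.isMAccretive hB.toIsMAccretive).isBoundedBelowAt_of_le_norm hform
      (zero_le_one.trans hQ) (by positivity) hre' hnorm).restrictTo _).mono hlarge
  · refine (hlow w hre.le hnorm.le).mono ?_
    calc min (m / (1 + ρ)) (1 / (4 * (1 + Q))) * (1 + ‖w‖) ≤ m / (1 + ρ) * (1 + ρ) := by
          gcongr
          exact min_le_left _ _
      _ = m := div_mul_cancel₀ _ (by positivity)

theorem exists_truncatedSector (hA : IsCoupling A B e o g χ) (hB : IsGapped B e T q b)
    (hT : 0 < T) (hχ : 0 < χ) :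
    ∃ γ p c : ℝ, 0 < γ ∧ γ < 1 ∧ 0 < p ∧ 0 < c ∧
      pspectrum (restrictTo (coupledOp A B) (ℂ ∙ lp.single 2 o e)ᗮ) ⊆ truncatedSector T γ p c ∧
      ∃ C : ℝ, ∀ w : ℂ, w ∉ {0} ∪ truncatedSector T γ p c →
        ∃ R, IsResolvent (coupledOp A B) w R ∧
          ‖R‖ ≤ C / Metric.infDist w ({0} ∪ truncatedSector T γ p c) := by
  obtain ⟨γ, p, c, m, hγ₀, hγ₁, hp, hc, hm, hlow⟩ :=
    hA.exists_isBoundedBelowAt_of_notMem_truncatedSector hB hT hχ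
  have hnull := hA.isNullVector hB.toIsNullVector
  have hres : ∀ w ∉ truncatedSector T γ p c,
      ∃ R, IsResolvent (restrictTo (coupledOp A B) (ℂ ∙ lp.single 2 o e)ᗮ) w R := fun w hw =>
    (hnull.isMAccretive_restrictTo
      (hA.isMAccretive hB.toIsMAccretive)).exists_isResolvent_of_notMem_truncatedSector hp.le hm
      (fun w hw => (hlow w hw).mono (le_mul_of_one_le_right hm.le (by simp))) hw
  refine ⟨γ, p, c, hγ₀, hγ₁, hp, hc, fun w hw => by_contra fun h => hw (hres w h), 1 / m + 1,
    fun w hw => ?_⟩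
  have hw' : w ∉ truncatedSector T γ p c := fun h => hw (Or.inr h)
  exact hnull.exists_isResolvent_norm_le (isClosed_truncatedSector T γ p c) hm hw
    ((hlow w hw').mono (by gcongr; linarith)) (hres w hw')

end IsCoupling

end Coupling

/-! ### The hopping and potential terms -/

section Multiplication

variable {α : Type*} [MeasurableSpace α] {ν : Measure α}

theorem coeFn_mulL2 (m : Lp ℂ ∞ ν) (f : Lp ℂ 2 ν) : mulL2 m f =ᵐ[ν] fun a => m a * f a :=
  (ContinuousLinearMap.mul ℂ ℂ).coeFn_holder (r := 2) m f

theorem inner_mulL2 {m : Lp ℂ ∞ ν} (hm : ∀ᵐ a ∂ν, starRingEnd ℂ (m a) = m a) (f g : Lp ℂ 2 ν) :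
    ⟪f, mulL2 m g⟫_ℂ = ⟪mulL2 m f, g⟫_ℂ := by
  rw [L2.inner_def, L2.inner_def]
  refine integral_congr_ae ?_
  filter_upwards [coeFn_mulL2 m f, coeFn_mulL2 m g, hm] with a hf hg ha
  rw [hf, hg, ← smul_eq_mul, ← smul_eq_mul, inner_smul_left, inner_smul_right, ha]

theorem norm_const_one [IsProbabilityMeasure ν] : ‖Lp.const 2 ν (1 : ℂ)‖ = 1 := by
  rw [Lp.norm_const' 2 ν 1 two_ne_zero ENNReal.ofNat_ne_top, norm_one, probReal_univ,
    Real.one_rpow, mul_one]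

theorem inner_const_one [IsFiniteMeasure ν] (f : Lp ℂ 2 ν) :
    ⟪Lp.const 2 ν (1 : ℂ), f⟫_ℂ = ∫ a, f a ∂ν := by
  rw [← indicatorConstLp_univ, L2.inner_indicatorConstLp_one, setIntegral_univ]

end Multiplication

section Translate

variable {d : ℕ} {Ω : Type*} [MeasurableSpace Ω] {μ : Measure Ω}

theorem translate_apply (ζ : Fin d → ℤ) (U : Lp ℂ 2 μ →L[ℂ] Lp ℂ 2 μ) (x : AugSpace d μ)
    (i : Fin d → ℤ) : translate ζ U x i = U (x (i - ζ)) := rfl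

theorem norm_translate_le (ζ : Fin d → ℤ) (U : Lp ℂ 2 μ →L[ℂ] Lp ℂ 2 μ) :
    ‖translate ζ U‖ ≤ ‖U‖ := by
  have h : ‖translate ζ U‖ ≤ max ‖U‖ 0 := by
    unfold translate blockOp
    exact LinearMap.mkContinuous_norm_le _ (le_max_right _ _) _
  rwa [max_eq_left (norm_nonneg U)] at h

theorem inner_translate {U U' : Lp ℂ 2 μ →L[ℂ] Lp ℂ 2 μ} (h : ∀ f g, ⟪f, U g⟫_ℂ = ⟪U' f, g⟫_ℂ)
    (ζ : Fin d → ℤ) (x y : AugSpace d μ) :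
    ⟪x, translate ζ U y⟫_ℂ = ⟪translate (-ζ) U' x, y⟫_ℂ := by
  rw [lp.inner_eq_tsum, lp.inner_eq_tsum, ← (Equiv.addRight ζ).tsum_eq]
  refine tsum_congr fun i => ?_
  rw [translate_apply, translate_apply, h, Equiv.coe_addRight, sub_neg_eq_add, add_sub_cancel_right]

end Translate

namespace Environment

variable {d : ℕ} {Ω : Type*} [MeasurableSpace Ω] {μ : Measure Ω} [TopologicalSpace Ω]
  (X : Environment d μ)

theorem shiftL2_shiftL2_neg (ζ : Fin d → ℤ) (f : Lp ℂ 2 μ) :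
    X.shiftL2 ζ (X.shiftL2 (-ζ) f) = f := by
  have hσ : X.σ (-ζ) ∘ X.σ ζ = id := by rw [X.σ_add, neg_add_cancel, X.σ_zero]
  change Lp.compMeasurePreserving _ (X.σ_preserving ζ)
    (Lp.compMeasurePreserving _ (X.σ_preserving (-ζ)) f) = f
  rw [← Lp.compMeasurePreserving_comp_apply]
  simp only [hσ]
  exact Lp.compMeasurePreserving_id_apply f

theorem inner_shiftL2 (ζ : Fin d → ℤ) (f g : Lp ℂ 2 μ) :
    ⟪f, X.shiftL2 ζ g⟫_ℂ = ⟪X.shiftL2 (-ζ) f, g⟫_ℂ := by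
  nth_rewrite 1 [← X.shiftL2_shiftL2_neg ζ f]
  exact LinearIsometry.inner_map_map _ _ _

/-- The contribution of jumps by `ζ` to the hopping term at zero momentum. -/
def jump (ζ : Fin d → ℤ) : AugSpace d μ →L[ℂ] AugSpace d μ :=
  translate ζ (ContinuousLinearMap.id ℂ (Lp ℂ 2 μ)) - translate ζ (X.shiftL2 ζ)

theorem inner_jump (ζ : Fin d → ℤ) (x y : AugSpace d μ) :
    ⟪x, X.jump ζ y⟫_ℂ = ⟪X.jump (-ζ) x, y⟫_ℂ := by
  simp only [jump, sub_apply, inner_sub_left, inner_sub_right]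
  rw [inner_translate (U' := ContinuousLinearMap.id ℂ (Lp ℂ 2 μ)) (fun _ _ => rfl),
    inner_translate (X.inner_shiftL2 ζ)]

theorem norm_jump_le (ζ : Fin d → ℤ) : ‖X.jump ζ‖ ≤ 2 :=
  calc ‖X.jump ζ‖ ≤ ‖ContinuousLinearMap.id ℂ (Lp ℂ 2 μ)‖ + ‖X.shiftL2 ζ‖ :=
        (norm_sub_le _ _).trans (add_le_add (norm_translate_le ζ _) (norm_translate_le ζ _))
    _ ≤ 1 + 1 := add_le_add ContinuousLinearMap.norm_id_le
        (LinearIsometry.norm_toContinuousLinearMap_le _)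
    _ = 2 := one_add_one_eq_two

theorem summable_jump (k : HoppingKernel d) :
    Summable fun ζ : Fin d → ℤ => k.h ζ • X.jump ζ := by
  obtain ⟨m, hm, hsum⟩ := k.exp_bound
  refine Summable.of_norm_bounded (hsum.mul_right 2) fun ζ => ?_
  rw [norm_smul]
  gcongr
  · exact le_mul_of_one_le_left (norm_nonneg _) (Real.one_le_exp (by positivity))
  · exact X.norm_jump_le ζ

theorem hasSum_jump (k : HoppingKernel d) :
    HasSum (fun ζ : Fin d → ℤ => k.h ζ • X.jump ζ) (X.hopping k 0) := by
  convert (X.summable_jump k).hasSum using 1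
  simp [hopping, jump]

/-- The adjoint of a jump by `ζ` is a jump by `-ζ`, and `h(-ζ)` is conjugate to `h(ζ)`. -/
theorem inner_hopping (k : HoppingKernel d) (x y : AugSpace d μ) :
    ⟪x, X.hopping k 0 y⟫_ℂ = ⟪X.hopping k 0 x, y⟫_ℂ := by
  have hleft : HasSum (fun ζ => ⟪x, (k.h ζ • X.jump ζ) y⟫_ℂ) ⟪x, X.hopping k 0 y⟫_ℂ :=
    ((X.hasSum_jump k).mapL (ContinuousLinearMap.apply ℂ _ y)).mapL (innerSL ℂ x)
  have hright : HasSum (fun ζ => ⟪(k.h ζ • X.jump ζ) x, y⟫_ℂ) ⟪X.hopping k 0 x, y⟫_ℂ := by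
    have h := ((X.hasSum_jump k).mapL (ContinuousLinearMap.apply ℂ _ x)).mapL (innerSL ℂ y)
    simpa only [innerSL_apply_apply, ContinuousLinearMap.apply_apply, ← starRingEnd_apply,
      inner_conj_symm] using h.star
  refine hleft.unique ((Equiv.neg _).hasSum_iff.1 ?_)
  convert hright using 2 with ζ
  simp only [Function.comp_apply, Equiv.neg_apply, smul_apply, inner_smul_left, inner_smul_right]
  rw [X.inner_jump, neg_neg, k.self_adjoint ζ, starRingEnd_self_apply]

theorem coeFn_potentialAt_sub {v : Ω → ℝ} (hv : MemLp v ∞ μ) (x : Fin d → ℤ) :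
    (X.potentialAt hv x - X.potentialAt hv 0 : Lp ℂ ∞ μ) =ᵐ[μ]
      fun ω => ((v (X.σ x ω) - v (X.σ 0 ω) : ℝ) : ℂ) := by
  filter_upwards [Lp.coeFn_sub (X.potentialAt hv x) (X.potentialAt hv 0),
    (X.memLp_ofReal_shift hv x).coeFn_toLp, (X.memLp_ofReal_shift hv 0).coeFn_toLp]
    with ω hsub hx h₀
  rw [hsub, Pi.sub_apply, potentialAt, potentialAt, hx, h₀, Complex.ofReal_sub]

theorem potential_apply {v : Ω → ℝ} (hv : MemLp v ∞ μ) (φ : AugSpace d μ) (x : Fin d → ℤ) :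
    X.potential hv φ x = mulL2 (X.potentialAt hv x - X.potentialAt hv 0) (φ x) := rfl

theorem inner_potential {v : Ω → ℝ} (hv : MemLp v ∞ μ) (x y : AugSpace d μ) :
    ⟪x, X.potential hv y⟫_ℂ = ⟪X.potential hv x, y⟫_ℂ := by
  rw [lp.inner_eq_tsum, lp.inner_eq_tsum]
  refine tsum_congr fun i => inner_mulL2 ?_ _ _
  filter_upwards [X.coeFn_potentialAt_sub hv i] with ω hω
  rw [hω, Complex.conj_ofReal]

theorem L_zero_eq (k : HoppingKernel d) {v : Ω → ℝ} (hv : MemLp v ∞ μ) :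
    X.L k hv 0 = coupledOp (X.hopping k 0 + X.potential hv) X.B := by
  rw [L, coupledOp, smul_add]

variable [IsProbabilityMeasure μ]

theorem jump_alongPart (ζ : Fin d → ℤ) (x : AugSpace d μ) :
    X.jump ζ (alongPart (Lp.const 2 μ 1) x) = 0 := by
  have hconst : X.shiftL2 ζ (Lp.const 2 μ 1) = Lp.const 2 μ 1 := rfl
  ext i : 2
  change alongPart (Lp.const 2 μ 1) x (i - ζ) -
    X.shiftL2 ζ (alongPart (Lp.const 2 μ 1) x (i - ζ)) = 0
  rw [alongPart_apply, map_smul, hconst, sub_self]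

theorem hopping_alongPart (k : HoppingKernel d) (x : AugSpace d μ) :
    X.hopping k 0 (alongPart (Lp.const 2 μ 1) x) = 0 := by
  have hsum := (X.hasSum_jump k).mapL
    (ContinuousLinearMap.apply ℂ _ (alongPart (Lp.const 2 μ 1) x))
  refine hsum.unique ?_
  simp [X.jump_alongPart, hasSum_zero]

/-- The function `v_x - v_0` in `L²`. -/
def potentialDiff {v : Ω → ℝ} (hv : MemLp v ∞ μ) (x : Fin d → ℤ) : Lp ℂ 2 μ :=
  mulL2 (X.potentialAt hv x - X.potentialAt hv 0) (Lp.const 2 μ 1)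

theorem coeFn_potentialDiff {v : Ω → ℝ} (hv : MemLp v ∞ μ) (x : Fin d → ℤ) :
    X.potentialDiff hv x =ᵐ[μ] fun ω => ((v (X.σ x ω) - v (X.σ 0 ω) : ℝ) : ℂ) := by
  filter_upwards [X.coeFn_potentialAt_sub hv x,
    coeFn_mulL2 (X.potentialAt hv x - X.potentialAt hv 0) (Lp.const 2 μ 1),
    Lp.coeFn_const 2 μ (1 : ℂ)] with ω hsub hmul hconst
  rw [potentialDiff, hmul, hsub, hconst, Function.const_apply, mul_one]

theorem inner_const_one_potentialDiff {v : Ω → ℝ} (hv : MemLp v ∞ μ) (x : Fin d → ℤ) :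
    ⟪Lp.const 2 μ (1 : ℂ), X.potentialDiff hv x⟫_ℂ = 0 := by
  have hintegral (y : Fin d → ℤ) : ∫ ω, v (X.σ y ω) ∂μ = ∫ ω, v ω ∂μ := by
    have hσ := X.σ_preserving y
    conv_rhs => rw [← hσ.map_eq]
    exact (integral_map hσ.aemeasurable (by rw [hσ.map_eq]; exact hv.1)).symm
  have hintegrable (y : Fin d → ℤ) : Integrable (fun ω => v (X.σ y ω)) μ :=
    (hv.comp_measurePreserving (X.σ_preserving y)).integrable le_top
  rw [inner_const_one, integral_congr_ae (X.coeFn_potentialDiff hv x), integral_complex_ofReal,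
    integral_sub (hintegrable x) (hintegrable 0), hintegral, hintegral, sub_self,
    Complex.ofReal_zero]

theorem isCoupling (k : HoppingKernel d) {v : Ω → ℝ} (hv : MemLp v ∞ μ) {χ : ℝ}
    (hnd : X.PotentialNondegenerate v χ) :
    IsCoupling (X.hopping k 0 + X.potential hv) X.B (Lp.const 2 μ 1) 0 (X.potentialDiff hv) χ where
  symm x y := by
    rw [add_apply, add_apply, inner_add_left, inner_add_right, X.inner_hopping, X.inner_potential]
  apply_alongPart x i := by
    rw [add_apply, X.hopping_alongPart, zero_add, potential_apply, alongPart_apply, map_smul]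
    rfl
  apply_origin := by
    rw [potentialDiff, sub_self, mulL2, map_zero, zero_apply]
  inner_eq_zero := X.inner_const_one_potentialDiff hv
  nondegenerate i hi u hu hmean := by
    obtain ⟨u, rfl, hBu : X.B u = _⟩ := (LinearPMap.mem_graph_iff _).1 hu
    refine hnd i hi u (by rwa [← inner_const_one]) ?_
    rw [hBu]
    exact X.coeFn_potentialDiff hv i

theorem isNullVector_B : IsNullVector X.B (Lp.const 2 μ 1) where
  norm_eq_one := norm_const_one
  mem_graph := by
    rw [B, mem_generator_graph]
    simp only [adjSemigroup_const, sub_self, smul_zero]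
    exact tendsto_const_nhds
  inner_eq_zero x z hxz := by
    rw [B, mem_generator_graph] at hxz
    refine tendsto_nhds_unique ((tendsto_const_nhds (x := Lp.const 2 μ (1 : ℂ))).inner hxz) ?_
    simp only [inner_smul_right, inner_sub_right, inner_const_adjSemigroup, sub_self, mul_zero]
    exact tendsto_const_nhds

theorem isGapped_B [BorelSpace Ω] {T q b : ℝ} (hgap : X.HasGap T) (hsec : X.IsSectorial q b) :
    IsGapped X.B (Lp.const 2 μ 1) T q b where
  __ := X.isNullVector_B
  __ := X.isMAccretive_B
  gap x z hxz hmean := by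
    obtain ⟨x, rfl, rfl⟩ := (LinearPMap.mem_graph_iff _).1 hxz
    exact hgap x (by rwa [← inner_const_one])
  sectorial x z hxz hmean hnorm := by
    obtain ⟨x, rfl, rfl⟩ := (LinearPMap.mem_graph_iff _).1 hxz
    exact hsec x (by rwa [← inner_const_one]) hnorm

end Environment

end MarkovAnderson

end

theorem mainTheorem4_general {ι E : Type*} [DecidableEq ι] [NormedAddCommGroup E]
    [InnerProductSpace ℂ E] [CompleteSpace E]
    {A : lp (fun _ : ι => E) 2 →L[ℂ] lp (fun _ : ι => E) 2} {B : E →ₗ.[ℂ] E}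
    {e : E} {o : ι} {g : ι → E} {χ T q b : ℝ} (hA : IsCoupling A B e o g χ)
    (hB : IsGapped B e T q b) (hT : 0 < T) (hχ : 0 < χ) :
    Dense ((coupledOp A B).domain : Set (lp (fun _ : ι => E) 2)) ∧
    (∃ h : lp.single 2 o e ∈ (coupledOp A B).domain, coupledOp A B ⟨lp.single 2 o e, h⟩ = 0) ∧
    (∃ h : lp.single 2 o e ∈ (coupledOp A B).adjoint.domain,
      (coupledOp A B).adjoint ⟨lp.single 2 o e, h⟩ = 0) ∧
    (∀ x : (coupledOp A B).domain, (x : lp (fun _ : ι => E) 2) ∈ (ℂ ∙ lp.single 2 o e)ᗮ →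
      coupledOp A B x ∈ (ℂ ∙ lp.single 2 o e)ᗮ) ∧
    ∃ γ p c : ℝ, 0 < γ ∧ γ < 1 ∧ 0 < p ∧ 0 < c ∧
      pspectrum (restrictTo (coupledOp A B) (ℂ ∙ lp.single 2 o e)ᗮ) ⊆ truncatedSector T γ p c ∧
      ∃ C : ℝ, ∀ w : ℂ, w ∉ {0} ∪ truncatedSector T γ p c →
        ∃ R, IsResolvent (coupledOp A B) w R ∧
          ‖R‖ ≤ C / Metric.infDist w ({0} ∪ truncatedSector T γ p c) :=
  have hnull := hA.isNullVector hB.toIsNullVector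
  have hdense := (hA.isMAccretive hB.toIsMAccretive).dense_domain
  ⟨hdense, hnull.exists_apply_eq_zero, hnull.exists_adjoint_apply_eq_zero hdense,
    fun x _ => hnull.apply_mem_orthogonal x, hA.exists_truncatedSector hB hT hχ⟩

theorem mainTheorem4 {d : ℕ} {Ω : Type*} [TopologicalSpace Ω] [MeasurableSpace Ω] [BorelSpace Ω]
    {μ : Measure Ω} [IsProbabilityMeasure μ]
    (k : HoppingKernel d) (X : Environment d μ)
    (T q b : ℝ) (hT : 0 < T) (hgap : X.HasGap T) (hsec : X.IsSectorial q b)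
    (v : Ω → ℝ) (hv : MemLp v ∞ μ) (χ : ℝ) (hχ : 0 < χ) (hnd : X.PotentialNondegenerate v χ) :
    -- `L̂₀` is densely defined, and `δ₀ ⊗ 1` is in the kernel of `L̂₀` and of its adjoint
    Dense ((X.L k hv 0).domain : Set (AugSpace d μ)) ∧
    (∃ hδ : deltaOne d μ ∈ (X.L k hv 0).domain, X.L k hv 0 ⟨deltaOne d μ, hδ⟩ = 0) ∧
    (∃ hδ : deltaOne d μ ∈ (X.L k hv 0).adjoint.domain, (X.L k hv 0).adjoint ⟨deltaOne d μ, hδ⟩ = 0) ∧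
    -- the orthogonal complement of `δ₀ ⊗ 1` is invariant
    (∀ φ : (X.L k hv 0).domain, (φ : AugSpace d μ) ∈ (ℂ ∙ deltaOne d μ)ᗮ →
      X.L k hv 0 φ ∈ (ℂ ∙ deltaOne d μ)ᗮ) ∧
    -- location of the spectrum and resolvent bound
    ∃ γ p c : ℝ, 0 < γ ∧ γ < 1 ∧ 0 < p ∧ 0 < c ∧
      pspectrum (restrictTo (X.L k hv 0) (ℂ ∙ deltaOne d μ)ᗮ) ⊆ truncatedSector T γ p c ∧
      ∃ C : ℝ, ∀ w : ℂ, w ∉ {0} ∪ truncatedSector T γ p c →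
        ∃ R : AugSpace d μ →L[ℂ] AugSpace d μ, IsResolvent (X.L k hv 0) w R ∧
          ‖R‖ ≤ C / Metric.infDist w ({0} ∪ truncatedSector T γ p c) := by
  rw [X.L_zero_eq k hv]
  exact mainTheorem4_general (X.isCoupling k hv hnd) (X.isGapped_B hgap hsec) hT hχ
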